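/- Let $P(\lambda)=A_0+A_1\lambda+\dots+A_d\lambda^d$ be a matrix polynomial of degree $d\ge 1$, with $A_j\in\mathbb C^{n\times n}$, $A_d\neq 0$ and $\det A_0\neq 0$. Let $\zeta_1,\dots,\zeta_{nd}$ be its eigenvalues, i.e. the roots of $\det P(\lambda)$ counted with multiplicity, completed by $nd-\deg\det P$ eigenvalues equal to $\infty$ (with $|\infty|=+\infty$), arranged by non-decreasing modulus. Let $\|\cdot\|$ be a norm on $\mathbb C^{n\times n}$ and put $c=|\det A_0|/\|A_0\|^n$. Consider the assumptions * (A1) $|\det A|\le\|A\|^n$ for all $A\in\mathbb C^{n\times n}$; * (A2) there are $Q,Q'\in\mathbb C^{n\times n}$ with $\det Q=\det Q'=1$ and $\|QAQ'\|_{\mathrm{nF}}\le\|A\|$ for all $A\in\mathbb C^{n\times n}$, where $\|A\|_{\mathrm{nF}}=\bigl(\frac1n\sum_{i,j}|A_{ij}|^2\bigr)^{1/2}$. Let $\mathsf t p(x)=\max_{0\le j\le d}\|A_j\|x^j$ for $x\ge 0$, and let $\alpha_1\le\dots\le\alpha_d$ be its tropical roots, i.e. the nonnegative numbers such that $\mathsf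 t p(x)=\|A_d\|\prod_{j=1}^d\max(x,\alpha_j)$ for all $x\ge 0$. Set $\alpha_0=0$ and $\alpha_{d+1}=+\infty$. Let $0=k_0<k_1<\dots<k_q=d$ be the abscissae of the vertices of the Newton polygon of $\mathsf t p$, the upper boundary of the convex hull of $\{(j,\lambda)\mid 0\le j\le d,\ A_j\ne 0,\ \lambda\le\log\|A_j\|\}\subset\mathbb R^2$. Let $\mathcal E(0)=1$ and $\mathcal E(m)=\left(\frac{m+1}{m}\right)^m$ for $m\ge 1$, and $$\mathcal U(m,\delta)=\mathcal E(m)\,\frac{1+\delta+\sqrt{m^2(1-\delta)^2+4\delta}}{1-\delta}\qquad(m\ge 0,\ 0\le\delta\le 1),$$ with $\mathcal U(m,1)=+\infty$ and $1/\infty=0$. For $1\le k\le d$ define $L_k^{\mathrm{opt}}=\max(L_k^{+,\mathrm{opt}},L_k^{-,\mathrm{opt}})$ and $L_k^{*,\mathrm{opt}}=\max(L_k^{+*,\mathrm{opt}},L_k^{-*,\mathrm{opt}})$, where $$L_k^{+,\mathrm{opt}}=\max_{j:\,k_j\ge k}\frac1{\mathcal U\bigl(k_j-k,\frac{\alpha_k}{\alpha_{k_j+1}}\bigr)},\qquad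 L_k^{-,\mathrm{opt}}=\max_{j:\,k_{j-1}<k}\frac1{\mathcal U\bigl(k-k_{j-1},\frac{\alpha_{k_{j-1}}}{\alpha_k}\bigr)},$$ $$L_k^{+*,\mathrm{opt}}=\max_{j:\,k_j\ge k}\frac1{\sqrt{\mathcal U\bigl(k_j-k,(\frac{\alpha_k}{\alpha_{k_j+1}})^2\bigr)}},\qquad L_k^{-*,\mathrm{opt}}=\max_{j:\,k_{j-1}<k}\frac1{\sqrt{\mathcal U\bigl(k-k_{j-1},(\frac{\alpha_{k_{j-1}}}{\alpha_k})^2\bigr)}}.$$ Then, for all $1\le k\le d$: 1. If $\|\cdot\|$ satisfies (A1), then $$\frac{|\zeta_1\cdots\zeta_{nk}|}{(\alpha_1\cdots\alpha_k)^n}\ \ge\ c\,(L_k^{\mathrm{opt}})^n .$$ 2. If $\|\cdot\|$ satisfies (A2), then $$\frac{|\zeta_1\cdots\zeta_{nk}|}{(\alpha_1\cdots\alpha_k)^n}\ \ge\ c\,(L_k^{*,\mathrm{opt}})^n ,$$ and this improves the previous bound: $L_k^{\mathrm{opt}}\le L_k^{*,\mathrm{opt}}$ (for every norm). 3. The constants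 are the optimal ones. The numbers $L_k^{+,\mathrm{opt}}$ and $L_k^{+*,\mathrm{opt}}$ are the maxima over all integers $k^+$ with $k<k^+\le d+1$ of, respectively, $$\frac1{\mathcal U\bigl(k^+-k-1,\frac{\alpha_k}{\alpha_{k^+}}\bigr)},\qquad \frac1{\sqrt{\mathcal U\bigl(k^+-k-1,(\frac{\alpha_k}{\alpha_{k^+}})^2\bigr)}},$$ and the numbers $L_k^{-,\mathrm{opt}}$ and $L_k^{-*,\mathrm{opt}}$ are the maxima over all integers $k^-$ with $0\le k^-<k$ of, respectively, $$\frac1{\mathcal U\bigl(k-k^-,\frac{\alpha_{k^-}}{\alpha_k}\bigr)},\qquad \frac1{\sqrt{\mathcal U\bigl(k-k^-,(\frac{\alpha_{k^-}}{\alpha_k})^2\bigr)}}.$$ -/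

import Mathlib

open scoped ENNReal Polynomial

noncomputable section

namespace TropicalBound

/-! ### Matrix norms -/

/-- The normalized Frobenius norm `((1/n) ∑ |A i j|^2)^(1/2)`. -/
def normFrob {n : ℕ} (A : Matrix (Fin n) (Fin n) ℂ) : ℝ :=
  Real.sqrt ((1 / (n : ℝ)) * ∑ i, ∑ j, ‖A i j‖ ^ 2)

/-- `N` is a norm (a seminorm that vanishes only at `0`). -/
def IsNorm {n : ℕ} (N : Seminorm ℂ (Matrix (Fin n) (Fin n) ℂ)) : Prop :=
  ∀ A, N A = 0 → A = 0

/-- First assumption on the norm: `|det A| ≤ ‖A‖ ^ n` for all `A`. -/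
def AssumptionOne {n : ℕ} (N : Seminorm ℂ (Matrix (Fin n) (Fin n) ℂ)) : Prop :=
  ∀ A, ‖A.det‖ ≤ N A ^ n

/-- Second assumption on the norm: it dominates the normalized Frobenius norm of `Q * A * R`
for some fixed matrices `Q`, `R` of determinant one. -/
def AssumptionTwo {n : ℕ} (N : Seminorm ℂ (Matrix (Fin n) (Fin n) ℂ)) : Prop :=
  ∃ Q R : Matrix (Fin n) (Fin n) ℂ, Q.det = 1 ∧ R.det = 1 ∧
    ∀ A, normFrob (Q * A * R) ≤ N A

/-! ### Eigenvalues of a matrix polynomial -/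

/-- The scalar polynomial `det P(X)`. -/
def detPoly {n : ℕ} (P : (Matrix (Fin n) (Fin n) ℂ)[X]) : ℂ[X] :=
  (matPolyEquiv.symm P).det

/-- The eigenvalues of a (regular) matrix polynomial of degree `d`, with multiplicity: the roots
of `det P(X)`, completed by the eigenvalue `∞` so as to have `n * d` elements in total. -/
def eigenvalues {n : ℕ} (P : (Matrix (Fin n) (Fin n) ℂ)[X]) : Multiset (OnePoint ℂ) :=
  (detPoly P).roots.map (fun z : ℂ => (z : OnePoint ℂ)) +
    Multiset.replicate (n * P.natDegree - (detPoly P).natDegree) OnePoint.infty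

/-- The modulus of a finite or infinite eigenvalue. -/
def modulus (z : OnePoint ℂ) : ℝ≥0∞ :=
  z.elim ⊤ (fun w : ℂ => ENNReal.ofReal ‖w‖)

/-- `ζ` lists the eigenvalues of `P`, each repeated according to its multiplicity,
by non-decreasing modulus (`ζ i` is the eigenvalue number `i + 1`). -/
def IsEigenvalueList {n : ℕ} (P : (Matrix (Fin n) (Fin n) ℂ)[X])
    (ζ : Fin (n * P.natDegree) → OnePoint ℂ) : Prop :=
  Finset.univ.val.map ζ = eigenvalues P ∧ Monotone (fun i => modulus (ζ i))

/-! ### Tropical polynomials -/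

/-- The max-times polynomial function `x ↦ max_{0 ≤ j ≤ d} a j * x ^ j`. -/
def tropPoly (a : ℕ → ℝ) (d : ℕ) (x : ℝ) : ℝ :=
  (Finset.range (d + 1)).sup' Finset.nonempty_range_add_one (fun j => a j * x ^ j)

/-- `α 0 ≤ ⋯ ≤ α (d - 1)` are the `d` tropical roots, with multiplicity, of the max-times
polynomial of degree `d` with coefficients `a`: they are the nonnegative numbers in its
factorization `a d * ∏ max x (α i)`. -/
def IsTropicalRoots (a : ℕ → ℝ) (d : ℕ) (α : Fin d → ℝ) : Prop :=
  Monotone α ∧ (∀ i, 0 ≤ α i) ∧ ∀ x : ℝ, 0 ≤ x → tropPoly a d x = a d * ∏ i, max x (α i)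

/-- The tropical roots with the usual numbering `1, …, d`, extended by the value `0` at the
index `0` and by `∞` beyond `d`. -/
def extRoot {d : ℕ} (α : Fin d → ℝ) (j : ℕ) : ℝ≥0∞ :=
  if j = 0 then 0
  else if h : j - 1 < d then ENNReal.ofReal (α ⟨j - 1, h⟩)
  else ⊤

/-- The region whose convex hull has the Newton polygon as its upper boundary: the half-lines
below the points `(j, log (a j))`, `0 ≤ j ≤ d`, `a j ≠ 0`. -/
def newtonRegion (a : ℕ → ℝ) (d : ℕ) : Set (ℝ × ℝ) :=
  {p | ∃ j : ℕ, j ≤ d ∧ 0 < a j ∧ p.1 = (j : ℝ) ∧ p.2 ≤ Real.log (a j)}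

open Classical in
/-- The abscissae of the vertices of the Newton polygon. (The vertices are the extreme points of
the convex hull; these belong to the region, so that their abscissae are integers.) -/
def newtonVertices (a : ℕ → ℝ) (d : ℕ) : Finset ℕ :=
  (Finset.range (d + 1)).filter fun k =>
    ∃ y : ℝ, ((k : ℝ), y) ∈ Set.extremePoints ℝ (convexHull ℝ (newtonRegion a d))

/-! ### The constants -/

/-- `((k + 1) / k) ^ k`, and `1` for `k = 0`. -/
def calE (k : ℕ) : ℝ :=
  if k = 0 then 1 else (((k : ℝ) + 1) / k) ^ k

/-- The function `𝒰(k, δ)` for `0 ≤ δ ≤ 1`, equal to `∞` for `δ = 1`. -/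
def calU (k : ℕ) (δ : ℝ) : ℝ≥0∞ :=
  ENNReal.ofReal (calE k * (1 + δ + Real.sqrt ((k : ℝ) ^ 2 * (1 - δ) ^ 2 + 4 * δ))) /
    ENNReal.ofReal (1 - δ)

/-- The ratio of the roots with indices `i` and `j`; it is used for `i ≤ j` only. -/
def ratio {d : ℕ} (α : Fin d → ℝ) (i j : ℕ) : ℝ :=
  (extRoot α i / extRoot α j).toReal

/-- The constant `1 / 𝒰(kp - k - 1, α_k / α_kp)`, for `k < kp ≤ d + 1`. -/
def LPlus {d : ℕ} (α : Fin d → ℝ) (k kp : ℕ) : ℝ≥0∞ :=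
  1 / calU (kp - k - 1) (ratio α k kp)

/-- The constant `1 / 𝒰(k - km, α_km / α_k)`, for `0 ≤ km < k`. -/
def LMinus {d : ℕ} (α : Fin d → ℝ) (k km : ℕ) : ℝ≥0∞ :=
  1 / calU (k - km) (ratio α km k)

/-- The constant `1 / √𝒰(kp - k - 1, (α_k / α_kp)^2)`, for `k < kp ≤ d + 1`. -/
def LPlusStar {d : ℕ} (α : Fin d → ℝ) (k kp : ℕ) : ℝ≥0∞ :=
  1 / (calU (kp - k - 1) (ratio α k kp ^ 2)) ^ (1 / 2 : ℝ)

/-- The constant `1 / √𝒰(k - km, (α_km / α_k)^2)`, for `0 ≤ km < k`. -/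
def LMinusStar {d : ℕ} (α : Fin d → ℝ) (k km : ℕ) : ℝ≥0∞ :=
  1 / (calU (k - km) (ratio α km k ^ 2)) ^ (1 / 2 : ℝ)

/-- Maximum of `1 / 𝒰(v - k, α_k / α_{v+1})` over the vertex abscissae `v ≥ k`. -/
def LPlusOpt (a : ℕ → ℝ) {d : ℕ} (α : Fin d → ℝ) (k : ℕ) : ℝ≥0∞ :=
  ((newtonVertices a d).filter (fun v => k ≤ v)).sup
    fun v => 1 / calU (v - k) (ratio α k (v + 1))

/-- Maximum of `1 / 𝒰(k - v, α_v / α_k)` over the vertex abscissae `v < k`. -/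
def LMinusOpt (a : ℕ → ℝ) {d : ℕ} (α : Fin d → ℝ) (k : ℕ) : ℝ≥0∞ :=
  ((newtonVertices a d).filter (fun v => v < k)).sup
    fun v => 1 / calU (k - v) (ratio α v k)

/-- The larger of the two optimized constants. -/
def LOpt (a : ℕ → ℝ) {d : ℕ} (α : Fin d → ℝ) (k : ℕ) : ℝ≥0∞ :=
  max (LPlusOpt a α k) (LMinusOpt a α k)

/-- Maximum of `1 / √𝒰(v - k, (α_k / α_{v+1})^2)` over the vertex abscissae `v ≥ k`. -/
def LPlusStarOpt (a : ℕ → ℝ) {d : ℕ} (α : Fin d → ℝ) (k : ℕ) : ℝ≥0∞ :=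
  ((newtonVertices a d).filter (fun v => k ≤ v)).sup
    fun v => 1 / (calU (v - k) (ratio α k (v + 1) ^ 2)) ^ (1 / 2 : ℝ)

/-- Maximum of `1 / √𝒰(k - v, (α_v / α_k)^2)` over the vertex abscissae `v < k`. -/
def LMinusStarOpt (a : ℕ → ℝ) {d : ℕ} (α : Fin d → ℝ) (k : ℕ) : ℝ≥0∞ :=
  ((newtonVertices a d).filter (fun v => v < k)).sup
    fun v => 1 / (calU (k - v) (ratio α v k ^ 2)) ^ (1 / 2 : ℝ)

/-- The larger of the two optimized square-root constants. -/
def LStarOpt (a : ℕ → ℝ) {d : ℕ} (α : Fin d → ℝ) (k : ℕ) : ℝ≥0∞ :=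
  max (LPlusStarOpt a α k) (LMinusStarOpt a α k)

/-- The lower bound `|ζ_1 ⋯ ζ_{nk}| / (α_1 ⋯ α_k)^n ≥ c * L^n` with
`c = |det A_0| / ‖A_0‖^n`. -/
def MasterBound {n : ℕ} (N : Seminorm ℂ (Matrix (Fin n) (Fin n) ℂ))
    (P : (Matrix (Fin n) (Fin n) ℂ)[X]) (ζ : Fin (n * P.natDegree) → OnePoint ℂ)
    (α : Fin P.natDegree → ℝ) (k : ℕ) (L : ℝ≥0∞) : Prop :=
  ENNReal.ofReal (‖(P.coeff 0).det‖ / N (P.coeff 0) ^ n) * L ^ n ≤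
    (∏ i with i.val < n * k, modulus (ζ i)) /
      (∏ j with j.val < k, ENNReal.ofReal (α j)) ^ n

end TropicalBound

end

/-! Put b = α_1⋯α_k and Z = |ζ_1⋯ζ_{nk}|, and define the gap constant B ≥ 0 by B^n = c b^n / Z. The
two bounds say that B is at most certain values of 𝒰, or of √𝒰. They are trivial if Z = ∞; otherwise
ζ_1, …, ζ_{nk} are roots of det P. Let M(r) be the Mahler measure of det P(rX). Jensen's formula
gives |det A_0| r^{nk} ≤ M(r) Z for every r > 0 (`norm_coeff_zero_mul_pow_le`). Under (A1), M(r) ≤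
(Σ ‖A_j‖ r^j)^n. Under (A2), Hadamard's inequality, Jensen's inequality for log and Parseval give
M(r)² ≤ (Σ ‖A_j‖² r^{2j})^n. The tropical factorization yields ‖A_j‖ α_1⋯α_j ≤ ‖A_0‖
(`IsTropicalRoots.coeff_mul_prod_le`). Taking n-th roots, B ≤ Σ_j r^{j-k} (α_1⋯α_k)/(α_1⋯α_j); under
(A2), B² is at most the same sum with r and all α_i squared. Consecutive terms of this sum have
quotient r/α_{j+1}, and the term j = k is 1. For r = xα_k or r = α_k/x with x > 1, the terms are
dominated by a geometric sum of quotient 1/x on one side of k, and on the other by quotient x for m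
steps, then xδ, where δ is the ratio of the two roots delimiting the chosen block. The total is at
most `boundFun`, and a good choice of x turns it into 𝒰(m, δ) (`le_valU_of_forall_le`). For
optimality, 𝒰 is nondecreasing in m and infinite at δ = 1. An index between two equal tropical roots
can thus be moved towards k without loss, until it meets a strict jump of the roots, which is a
vertex of the Newton polygon. -/

namespace TropicalBound

/-! ### The function `𝒰` -/

/-- The real value of `𝒰(m, δ)`, meaningful for `δ < 1`. -/
noncomputable def valU (m : ℕ) (δ : ℝ) : ℝ :=
  calE m * (1 + δ + Real.sqrt ((m : ℝ) ^ 2 * (1 - δ) ^ 2 + 4 * δ)) / (1 - δ)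

lemma one_le_calE (m : ℕ) : 1 ≤ calE m := by
  unfold calE
  split_ifs with h
  · exact le_rfl
  · apply one_le_pow₀
    rw [le_div_iff₀ (by positivity)]
    linarith

/-- Bernoulli's inequality with exponent m + 1: the bases (m+2)/(m+1) and (m+1)/m have quotient 1 -
1/(m+1)². -/
lemma calE_mono : Monotone calE := by
  refine monotone_nat_of_le_succ fun m => ?_
  rcases Nat.eq_zero_or_pos m with rfl | hm
  · simp [calE]
  · have hm' : (0 : ℝ) < m := by exact_mod_cast hm
    have h := one_add_mul_le_pow (a := -(1 / ((m : ℝ) + 1) ^ 2))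
      (by rw [neg_le_neg_iff, div_le_iff₀ (by positivity)]; nlinarith) (m + 1)
    simp only [calE, hm.ne', Nat.succ_ne_zero, if_false]
    have e1 : (((m + 1 : ℕ) : ℝ) + 1) / ((m + 1 : ℕ) : ℝ)
        = (1 + -(1 / ((m : ℝ) + 1) ^ 2)) * (((m : ℝ) + 1) / m) := by
      push_cast; field_simp; ring
    rw [e1, mul_pow, pow_succ (((m : ℝ) + 1) / m)]
    have e2 : 1 + ((m + 1 : ℕ) : ℝ) * -(1 / ((m : ℝ) + 1) ^ 2) = m / (m + 1) := by
      push_cast; field_simp; ring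
    rw [e2] at h
    calc (((m : ℝ) + 1) / m) ^ m
        = (m / (m + 1)) * ((((m : ℝ) + 1) / m) ^ m * (((m : ℝ) + 1) / m)) := by field_simp
      _ ≤ _ := by gcongr

lemma calU_eq_valU {m : ℕ} {δ : ℝ} (h1 : δ < 1) :
    calU m δ = ENNReal.ofReal (valU m δ) := by
  rw [calU, valU, ENNReal.ofReal_div_of_pos (by linarith)]

lemma calU_one (m : ℕ) : calU m 1 = ⊤ := by
  have := one_le_calE m
  rw [calU, sub_self, ENNReal.ofReal_zero, ENNReal.div_zero]
  rw [Ne, ENNReal.ofReal_eq_zero, not_le]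
  positivity

lemma valU_pos {m : ℕ} {δ : ℝ} (h0 : 0 ≤ δ) (h1 : δ < 1) : 0 < valU m δ := by
  have := one_le_calE m
  have : 0 < 1 - δ := by linarith
  unfold valU
  positivity

lemma calU_mono_left {m m' : ℕ} (h : m ≤ m') {δ : ℝ} (h0 : 0 ≤ δ) :
    calU m δ ≤ calU m' δ := by
  have := one_le_calE m
  have := calE_mono h
  have := zero_le_one.trans (one_le_calE m')
  unfold calU
  gcongr

/-- `𝒰(m, δ²) ≤ 𝒰(m, δ)²`. -/
lemma valU_sq_le {m : ℕ} {δ : ℝ} (h0 : 0 ≤ δ) (h1 : δ < 1) :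
    valU m (δ ^ 2) ≤ valU m δ ^ 2 := by
  have hE := one_le_calE m
  have hd : 0 < 1 - δ := by linarith
  set E := calE m with hEdef
  set S := Real.sqrt ((m : ℝ) ^ 2 * (1 - δ) ^ 2 + 4 * δ) with hS
  have hS0 : 0 ≤ S := Real.sqrt_nonneg _
  have hS2 : S ^ 2 = (m : ℝ) ^ 2 * (1 - δ) ^ 2 + 4 * δ := Real.sq_sqrt (by positivity)
  -- Both radicands contain m²(1-δ²)² once (1 + δ) is moved under the root; what remains is δ² ≤
  -- (1+δ)²δ.
  have hT : Real.sqrt ((m : ℝ) ^ 2 * (1 - δ ^ 2) ^ 2 + 4 * δ ^ 2) ≤ (1 + δ) * S := by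
    apply Real.sqrt_le_iff.2 ⟨by positivity, ?_⟩
    rw [mul_pow, hS2]
    nlinarith [mul_nonneg h0 hd.le, mul_nonneg h0 h0, mul_nonneg h0 (mul_nonneg h0 h0)]
  have hd2 : 1 - δ ^ 2 = (1 - δ) * (1 + δ) := by ring
  have hd2' : 0 < 1 - δ ^ 2 := by rw [hd2]; positivity
  unfold valU
  rw [← hEdef, ← hS, div_pow, div_le_div_iff₀ hd2' (by positivity)]
  have key : (1 + δ ^ 2 + (1 + δ) * S) * (1 - δ) ≤ (1 + δ) * (1 + δ + S) ^ 2 := by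
    have a1 : (1 + δ ^ 2 + (1 + δ) * S) * (1 - δ) ≤ (1 + δ) * (1 + δ + S) * 1 := by
      apply mul_le_mul _ (by linarith) hd.le (by positivity)
      nlinarith
    have a2 : (1 + δ) * (1 + δ + S) * 1 ≤ (1 + δ) * (1 + δ + S) * (1 + δ + S) := by
      gcongr; linarith
    calc _ ≤ _ := a1
      _ ≤ _ := a2
      _ = _ := by ring
  calc E * (1 + δ ^ 2 + Real.sqrt ((m : ℝ) ^ 2 * (1 - δ ^ 2) ^ 2 + 4 * δ ^ 2)) * (1 - δ) ^ 2
      ≤ E * (1 + δ ^ 2 + (1 + δ) * S) * (1 - δ) ^ 2 := by gcongr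
    _ = E * (1 - δ) * ((1 + δ ^ 2 + (1 + δ) * S) * (1 - δ)) := by ring
    _ ≤ (E * E) * (1 - δ) * ((1 + δ) * (1 + δ + S) ^ 2) := by
        gcongr
        nlinarith
    _ = (E * (1 + δ + S)) ^ 2 * (1 - δ ^ 2) := by rw [hd2]; ring

/-- The function whose infimum over `1 < x < 1 / δ` is bounded by `𝒰(m, δ)`. -/
noncomputable def boundFun (m : ℕ) (δ x : ℝ) : ℝ :=
  x ^ (m + 1) * (1 - δ) / ((x - 1) * (1 - x * δ))

/-- The critical points of `boundFun` in x solve (1-m)δx² + m(1+δ)x - (m+1) = 0, with discriminant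
S². The relevant solution, in the rationalized form 2(m+1)/(m(1+δ) + S), makes sense for m = 1 and δ
= 0 too. There x^m ≤ ℰ(m), and the other factor equals (1+δ+S)/(1-δ). -/
lemma le_valU_of_forall_le {m : ℕ} {δ B : ℝ} (h0 : 0 ≤ δ) (h1 : δ < 1)
    (hB : ∀ x : ℝ, 1 < x → x * δ < 1 → B ≤ boundFun m δ x) : B ≤ valU m δ := by
  have hd : 0 < 1 - δ := by linarith
  -- Here the denominator m(1+δ) + S vanishes: the infimum of x/(x-1) is 1, approached only as x →
  -- ∞.
  by_cases hz : m = 0 ∧ δ = 0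
  · obtain ⟨rfl, rfl⟩ := hz
    have e : valU 0 0 = 1 := by simp [valU, calE]
    rw [e]
    refine le_of_forall_pos_le_add fun η hη => ?_
    refine (hB (1 + 1 / η) (by simp [hη]) (by simp)).trans (le_of_eq ?_)
    have hη' := hη.ne'
    have e' : boundFun 0 0 (1 + 1 / η) = (1 + 1 / η) / (1 / η) := by simp [boundFun]
    rw [e', div_eq_iff (by positivity)]
    field_simp
    ring
  set S := Real.sqrt ((m : ℝ) ^ 2 * (1 - δ) ^ 2 + 4 * δ) with hS
  have hS0 : 0 ≤ S := Real.sqrt_nonneg _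
  have hS2 : S ^ 2 = (m : ℝ) ^ 2 * (1 - δ) ^ 2 + 4 * δ := Real.sq_sqrt (by positivity)
  have hm0 : (0 : ℝ) ≤ m := Nat.cast_nonneg m
  have hSlow : (m : ℝ) * (1 - δ) ≤ S := by
    apply Real.le_sqrt_of_sq_le; nlinarith
  have hSup : S < m * (1 - δ) + 2 := by
    apply (Real.sqrt_lt' (by positivity)).2
    nlinarith [mul_nonneg hm0 hd.le]
  have hpos : 0 < m * (1 + δ) + S := by
    rcases h0.eq_or_lt with h | h
    · have : 0 < m := Nat.pos_of_ne_zero fun hm => hz ⟨hm, h.symm⟩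
      positivity
    · have : 0 < S := Real.sqrt_pos.2 (by positivity)
      positivity
  have hSd : 2 * δ - m * (1 - δ) < S := by
    rcases h0.eq_or_lt with h | h
    · rw [← h] at hpos ⊢; linarith
    · apply Real.lt_sqrt_of_sq_lt
      nlinarith [mul_nonneg hm0 hd.le, mul_nonneg h0 (mul_nonneg hm0 hd.le), mul_pos h hd]
  set D := m * (1 + δ) + S with hD
  set x := 2 * (m + 1) / D with hx
  have hx1 : 1 < x := by rw [hx, lt_div_iff₀ hpos]; nlinarith
  have hxd : x * δ < 1 := by
    rw [hx, div_mul_eq_mul_div, div_lt_one hpos]; nlinarith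
  refine (hB x hx1 hxd).trans ?_
  -- From S ≥ m(1-δ) follows D ≥ 2m, hence x ≤ (m+1)/m.
  have hxE : x ^ m ≤ calE m := by
    unfold calE
    split_ifs with hm
    · simp [hm]
    · have hm' : (0 : ℝ) < m := by positivity
      gcongr
      rw [hx, div_le_div_iff₀ hpos hm']
      nlinarith
  have hx0 : 0 < x := by linarith
  have hden : 0 < (x - 1) * (1 - x * δ) := mul_pos (by linarith) (by linarith)
  have hmain : x * (1 - δ) / ((x - 1) * (1 - x * δ)) = (1 + δ + S) / (1 - δ) := by
    rw [div_eq_div_iff hden.ne' hd.ne']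
    have hxD : x * D = 2 * (m + 1) := by rw [hx]; field_simp
    have hD2 : D ^ 2 ≠ 0 := by positivity
    -- Multiplication by D² eliminates x through xD = 2(m+1); the rest is a polynomial identity
    -- modulo the value of S².
    apply mul_right_cancel₀ hD2
    have l1 : x * (1 - δ) * (1 - δ) * D ^ 2 = (x * D) * (1 - δ) ^ 2 * D := by ring
    have l2 : (1 + δ + S) * ((x - 1) * (1 - x * δ)) * D ^ 2
        = (1 + δ + S) * ((x * D - D) * (D - (x * D) * δ)) := by ring
    rw [l1, l2, hxD, hD]
    have hS3 : S ^ 3 = S * ((m : ℝ) ^ 2 * (1 - δ) ^ 2 + 4 * δ) := by rw [← hS2]; ring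
    ring_nf
    ring_nf at hS2 hS3
    rw [hS3, hS2]
    ring
  calc boundFun m δ x = x ^ m * (x * (1 - δ) / ((x - 1) * (1 - x * δ))) := by
        unfold boundFun; ring
    _ = x ^ m * ((1 + δ + S) / (1 - δ)) := by rw [hmain]
    _ ≤ calE m * ((1 + δ + S) / (1 - δ)) := by gcongr
    _ = valU m δ := by rw [valU, ← hS]; ring

/-! ### Geometric majorization -/

lemma sum_pow_succ_le {q : ℝ} (h0 : 0 ≤ q) (h1 : q < 1) (K : ℕ) :
    ∑ i ∈ Finset.range K, q ^ (i + 1) ≤ q / (1 - q) := by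
  have h := Summable.sum_le_tsum (Finset.range K) (fun i _ => pow_nonneg h0 i)
    (summable_geometric_of_lt_one h0 h1)
  rw [tsum_geometric_of_lt_one h0 h1] at h
  calc ∑ i ∈ Finset.range K, q ^ (i + 1) = q * ∑ i ∈ Finset.range K, q ^ i := by
        rw [Finset.mul_sum]; exact Finset.sum_congr rfl fun i _ => by ring
    _ ≤ q * (1 - q)⁻¹ := by gcongr
    _ = _ := rfl

/-- The three sums are at most 1/(x-1), (x^{m+1}-1)/(x-1) and x^m·xδ/(1-xδ), and these add up
exactly to `boundFun m δ x`. -/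
lemma three_sums_le_boundFun {m K M : ℕ} {δ x : ℝ} (h0 : 0 ≤ δ) (hx : 1 < x) (hxd : x * δ < 1)
    {A B C : ℕ → ℝ} (hA : ∀ i < K, A i ≤ (1 / x) ^ (i + 1)) (hB : ∀ i ≤ m, B i ≤ x ^ i)
    (hC : ∀ i < M, C i ≤ x ^ m * (x * δ) ^ (i + 1)) :
    ∑ i ∈ Finset.range K, A i + ∑ i ∈ Finset.range (m + 1), B i + ∑ i ∈ Finset.range M, C i
      ≤ boundFun m δ x := by
  have hx0 : 0 < x := by linarith
  have hx1 : 0 < x - 1 := by linarith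
  have hxd' : 0 < 1 - x * δ := by linarith
  have a : ∑ i ∈ Finset.range K, A i ≤ 1 / (x - 1) :=
    calc _ ≤ ∑ i ∈ Finset.range K, (1 / x) ^ (i + 1) :=
          Finset.sum_le_sum fun i hi => hA i (Finset.mem_range.1 hi)
      _ ≤ (1 / x) / (1 - 1 / x) :=
          sum_pow_succ_le (by positivity) ((div_lt_one hx0).2 hx) K
      _ = _ := by field_simp
  have b : ∑ i ∈ Finset.range (m + 1), B i ≤ (x ^ (m + 1) - 1) / (x - 1) := by
    rw [← geom_sum_eq hx.ne']
    exact Finset.sum_le_sum fun i hi => hB i (Nat.lt_succ_iff.1 (Finset.mem_range.1 hi))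
  have c : ∑ i ∈ Finset.range M, C i ≤ x ^ m * (x * δ / (1 - x * δ)) :=
    calc _ ≤ ∑ i ∈ Finset.range M, x ^ m * (x * δ) ^ (i + 1) :=
          Finset.sum_le_sum fun i hi => hC i (Finset.mem_range.1 hi)
      _ = x ^ m * ∑ i ∈ Finset.range M, (x * δ) ^ (i + 1) := by rw [Finset.mul_sum]
      _ ≤ _ := by
          gcongr
          exact sum_pow_succ_le (by positivity) hxd M
  have e : boundFun m δ x = 1 / (x - 1) + (x ^ (m + 1) - 1) / (x - 1)
      + x ^ m * (x * δ / (1 - x * δ)) := by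
    have h1' := hx1.ne'
    have h2' := hxd'.ne'
    have e1 : 1 / (x - 1) + (x ^ (m + 1) - 1) / (x - 1) = x ^ (m + 1) / (x - 1) := by ring
    have e2 : x ^ m * (x * δ / (1 - x * δ)) = x ^ (m + 1) * δ / (1 - x * δ) := by ring
    rw [e1, e2, div_add_div _ _ h1' h2', boundFun]
    congr 1
    ring
  linarith

/-! ### Products of consecutive ratios -/

/-- `R ^ j / ∏_{i < j} β i`, normalized to be `1` at `j = k`. -/
noncomputable def relTerm (β : ℕ → ℝ) (k : ℕ) (R : ℝ) (j : ℕ) : ℝ :=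
  R ^ j * (∏ i ∈ Finset.range k, β i) / (R ^ k * ∏ i ∈ Finset.range j, β i)

lemma relTerm_pos {β : ℕ → ℝ} (hβ : ∀ i, 0 < β i) {k : ℕ} {R : ℝ} (hR : 0 < R) (j : ℕ) : 0 < relTerm β k R j := by
  have := Finset.prod_pos (s := Finset.range k) fun i _ => hβ i
  have := Finset.prod_pos (s := Finset.range j) fun i _ => hβ i
  unfold relTerm
  positivity

lemma relTerm_self {β : ℕ → ℝ} (hβ : ∀ i, 0 < β i) {k : ℕ} {R : ℝ} (hR : 0 < R) : relTerm β k R k = 1 := by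
  have := Finset.prod_pos (s := Finset.range k) fun i _ => hβ i
  unfold relTerm
  rw [div_self (by positivity)]

lemma relTerm_succ {β : ℕ → ℝ} (hβ : ∀ i, 0 < β i) {k : ℕ} {R : ℝ} (hR : 0 < R) (j : ℕ) : relTerm β k R (j + 1) = relTerm β k R j * (R / β j) := by
  have := Finset.prod_pos (s := Finset.range k) fun i _ => hβ i
  have := Finset.prod_pos (s := Finset.range j) fun i _ => hβ i
  have := hβ j
  unfold relTerm
  rw [Finset.prod_range_succ]
  field_simp
  ring

lemma relTerm_add_le {β : ℕ → ℝ} (hβ : ∀ i, 0 < β i) {k : ℕ} {R : ℝ} (hR : 0 < R)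
    {s : ℕ} {M q : ℝ} (hs : relTerm β k R s ≤ M) (i : ℕ)
    (hq : ∀ l, s ≤ l → l < s + i → R / β l ≤ q) : relTerm β k R (s + i) ≤ M * q ^ i := by
  induction i with
  | zero => simpa using hs
  | succ i ih =>
    have h1 := ih fun l h h' => hq l h (by omega)
    have h2 := hq (s + i) (by omega) (by omega)
    have := (relTerm_pos hβ (k := k) hR (s + i)).le
    have := div_pos hR (hβ (s + i))
    rw [← add_assoc, relTerm_succ hβ hR, pow_succ, ← mul_assoc]
    exact mul_le_mul h1 h2 (by positivity) (by linarith)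

lemma relTerm_sub_le {β : ℕ → ℝ} (hβ : ∀ i, 0 < β i) {k : ℕ} {R : ℝ} (hR : 0 < R)
    {s : ℕ} {M q : ℝ} (hs : relTerm β k R s ≤ M) (i : ℕ) (hi : i ≤ s)
    (hq : ∀ l, s - i ≤ l → l < s → β l / R ≤ q) : relTerm β k R (s - i) ≤ M * q ^ i := by
  induction i with
  | zero => simpa using hs
  | succ i ih =>
    have h1 := ih (by omega) fun l h h' => hq l (by omega) h'
    have h2 := hq (s - (i + 1)) le_rfl (by omega)
    have h3 := relTerm_succ hβ (k := k) hR (s - (i + 1))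
    have hp := (relTerm_pos hβ (k := k) hR (s - i)).le
    have hb := hβ (s - (i + 1))
    rw [show s - (i + 1) + 1 = s - i by omega] at h3
    have h4 : relTerm β k R (s - (i + 1)) = relTerm β k R (s - i) * (β (s - (i + 1)) / R) := by
      rw [h3]; field_simp
    rw [h4, pow_succ, ← mul_assoc]
    exact mul_le_mul h1 h2 (by positivity) (by linarith)

/-- With numbering from 0, β (k-1) is α_k and R = xα_k. Upwards from k the quotients R/β_l are at
most x, and at most xδ from l = k+m on; downwards they are at most 1/x. For k + m = d there is no
last block, which is the convention α_{d+1} = ∞. -/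
lemma sum_relTerm_le_of_roots_above {β : ℕ → ℝ} (hβ : ∀ i, 0 < β i) (hmono : Monotone β)
    {k m d : ℕ} (hk : 1 ≤ k) (hkm : k + m ≤ d) {δ x : ℝ} (h0 : 0 ≤ δ)
    (hδ : k + m < d → β (k - 1) ≤ δ * β (k + m)) (hx : 1 < x) (hxd : x * δ < 1) :
    ∑ j ∈ Finset.range (d + 1), relTerm β k (x * β (k - 1)) j ≤ boundFun m δ x := by
  have hx0 : 0 < x := by linarith
  have hb := hβ (k - 1)
  have hR : 0 < x * β (k - 1) := by positivity
  set R := x * β (k - 1) with hRdef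
  have hself := (relTerm_self hβ (k := k) hR).le
  have hup : ∀ l, k - 1 ≤ l → R / β l ≤ x := fun l hl => by
    rw [div_le_iff₀ (hβ l)]
    exact mul_le_mul_of_nonneg_left (hmono hl) hx0.le
  have hB : ∀ i ≤ m, relTerm β k R (k + i) ≤ x ^ i := fun i _ => by
    simpa using relTerm_add_le hβ hR hself i fun l hl _ => hup l (by omega)
  have hA : ∀ i < k, relTerm β k R (k - 1 - i) ≤ (1 / x) ^ (i + 1) := fun i hi => by
    have := relTerm_sub_le hβ hR hself (i + 1) (by omega) (q := 1 / x) fun l _ hl => by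
      rw [div_le_div_iff₀ hR hx0, one_mul, hRdef, mul_comm]
      exact mul_le_mul_of_nonneg_left (hmono (by omega)) hx0.le
    rwa [one_mul, show k - (i + 1) = k - 1 - i by omega] at this
  have hC : ∀ i < d - (k + m), relTerm β k R (k + (m + 1) + i) ≤ x ^ m * (x * δ) ^ (i + 1) := by
    intro i hi
    have := relTerm_add_le hβ hR (hB m le_rfl) (i + 1) (q := x * δ) fun l hl _ => by
      rw [div_le_iff₀ (hβ l), hRdef, mul_assoc]
      refine mul_le_mul_of_nonneg_left ((hδ (by omega)).trans ?_) hx0.le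
      exact mul_le_mul_of_nonneg_left (hmono hl) h0
    rwa [show k + m + (i + 1) = k + (m + 1) + i by omega] at this
  have := three_sums_le_boundFun h0 hx hxd hA hB hC
  rwa [Finset.sum_range_reflect, ← Finset.sum_range_add, ← Finset.sum_range_add,
    show k + (m + 1) + (d - (k + m)) = d + 1 by omega] at this

/-- The mirror image, with R = α_k/x: the growing block now lies below k. For m = k the last block
is empty, in accordance with α_0 = 0. -/
lemma sum_relTerm_le_of_roots_below {β : ℕ → ℝ} (hβ : ∀ i, 0 < β i) (hmono : Monotone β)
    {k m d : ℕ} (hkd : k ≤ d) (hmk : m ≤ k) {δ x : ℝ} (h0 : 0 ≤ δ)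
    (hδ : m < k → β (k - m - 1) ≤ δ * β (k - 1)) (hx : 1 < x) (hxd : x * δ < 1) :
    ∑ j ∈ Finset.range (d + 1), relTerm β k (β (k - 1) / x) j ≤ boundFun m δ x := by
  have hx0 : 0 < x := by linarith
  have hb := hβ (k - 1)
  have hR : 0 < β (k - 1) / x := by positivity
  set R := β (k - 1) / x with hRdef
  have hRx : β (k - 1) = x * R := by rw [hRdef]; field_simp
  have hself := (relTerm_self hβ (k := k) hR).le
  have hA : ∀ i < d - k, relTerm β k R (k + 1 + i) ≤ (1 / x) ^ (i + 1) := fun i _ => by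
    have := relTerm_add_le hβ hR hself (i + 1) (q := 1 / x) fun l hl _ => by
      rw [div_le_div_iff₀ (hβ l) hx0, one_mul, mul_comm, ← hRx]
      exact hmono (by omega)
    rwa [one_mul, show k + (i + 1) = k + 1 + i by omega] at this
  have hB : ∀ i ≤ m, relTerm β k R (k - i) ≤ x ^ i := fun i hi => by
    have := relTerm_sub_le hβ hR hself i (by omega) (q := x) fun l _ hl => by
      rw [div_le_iff₀ hR, ← hRx]
      exact hmono (by omega)
    rwa [one_mul] at this
  have hC : ∀ i < k - m, relTerm β k R (k - m - 1 - i) ≤ x ^ m * (x * δ) ^ (i + 1) := by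
    intro i hi
    have := relTerm_sub_le hβ hR (hB m le_rfl) (i + 1) (by omega) (q := x * δ) fun l _ hl => by
      rw [div_le_iff₀ hR]
      calc β l ≤ β (k - m - 1) := hmono (by omega)
        _ ≤ δ * β (k - 1) := hδ (by omega)
        _ = x * δ * R := by rw [hRx]; ring
    rwa [show k - m - (i + 1) = k - m - 1 - i by omega] at this
  have h3 := three_sums_le_boundFun h0 hx hxd hA hB hC
  have hsum : ∑ i ∈ Finset.range (m + 1), relTerm β k R (k - i)
      = ∑ i ∈ Finset.range (m + 1), relTerm β k R (k - m + i) := by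
    rw [← Finset.sum_range_reflect]
    refine Finset.sum_congr rfl fun i hi => ?_
    have := Finset.mem_range.1 hi
    congr 1
    omega
  rw [Finset.sum_range_reflect, hsum] at h3
  have hsplit : ∑ j ∈ Finset.range (d + 1), relTerm β k R j
      = ∑ i ∈ Finset.range (k - m), relTerm β k R i
        + ∑ i ∈ Finset.range (m + 1), relTerm β k R (k - m + i)
        + ∑ i ∈ Finset.range (d - k), relTerm β k R (k + 1 + i) := by
    rw [← Finset.sum_range_add, show k - m + (m + 1) = k + 1 by omega, ← Finset.sum_range_add,
      show k + 1 + (d - k) = d + 1 by omega]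
  rw [hsplit]
  linarith

/-- Each weight w j is replaced by its largest admissible value w 0 / ∏_{i<j} β i, after which only
the β's remain. -/
lemma le_sum_relTerm {β w : ℕ → ℝ} (hβ : ∀ i, 0 < β i) {k d : ℕ} (hw0 : 0 < w 0)
    (hw : ∀ j ≤ d, w j * ∏ i ∈ Finset.range j, β i ≤ w 0) {B R : ℝ} (hR : 0 < R)
    (hB : B * w 0 * R ^ k ≤
      (∑ j ∈ Finset.range (d + 1), w j * R ^ j) * ∏ i ∈ Finset.range k, β i) :
    B ≤ ∑ j ∈ Finset.range (d + 1), relTerm β k R j := by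
  have hp : ∀ s, 0 < ∏ i ∈ Finset.range s, β i := fun s => Finset.prod_pos fun i _ => hβ i
  have hpk := hp k
  have h1 : B ≤ ((∑ j ∈ Finset.range (d + 1), w j * R ^ j) * ∏ i ∈ Finset.range k, β i)
      / (w 0 * R ^ k) := by
    rw [le_div_iff₀ (by positivity)]; linarith
  refine h1.trans ?_
  rw [Finset.sum_mul, Finset.sum_div]
  refine Finset.sum_le_sum fun j hj => ?_
  have hpj := hp j
  have h2 := hw j (Nat.lt_succ_iff.1 (Finset.mem_range.1 hj))
  unfold relTerm
  rw [div_le_div_iff₀ (by positivity) (by positivity)]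
  calc w j * R ^ j * (∏ i ∈ Finset.range k, β i) * (R ^ k * ∏ i ∈ Finset.range j, β i)
      = (w j * ∏ i ∈ Finset.range j, β i)
        * (R ^ j * (∏ i ∈ Finset.range k, β i) * R ^ k) := by ring
    _ ≤ w 0 * (R ^ j * (∏ i ∈ Finset.range k, β i) * R ^ k) := by gcongr
    _ = _ := by ring

/-! ### Tropical roots -/

lemma IsTropicalRoots.mul_pow_le {a : ℕ → ℝ} {d : ℕ} {α : Fin d → ℝ}
    (h : IsTropicalRoots a d α) {x : ℝ} (hx : 0 ≤ x) {j : ℕ} (hj : j ≤ d) :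
    a j * x ^ j ≤ a d * ∏ i, max x (α i) := by
  rw [← h.2.2 x hx]
  exact Finset.le_sup' (fun j => a j * x ^ j) (Finset.mem_range.2 (Nat.lt_succ_of_le hj))

lemma IsTropicalRoots.coeff_zero {a : ℕ → ℝ} {d : ℕ} {α : Fin d → ℝ}
    (h : IsTropicalRoots a d α) (ha : ∀ j, 0 ≤ a j) : a 0 = a d * ∏ i, α i := by
  have h0 := h.2.2 0 le_rfl
  simp only [max_eq_right (h.2.1 _)] at h0
  rw [← h0]
  refine le_antisymm ?_ ?_
  · have := Finset.le_sup' (fun j => a j * (0 : ℝ) ^ j) (Finset.mem_range.2 (Nat.succ_pos d))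
    simp only [pow_zero, mul_one] at this
    exact this
  · refine Finset.sup'_le _ _ fun j _ => ?_
    rcases j with _ | j
    · simp
    · simpa using ha 0

lemma IsTropicalRoots.pos {a : ℕ → ℝ} {d : ℕ} {α : Fin d → ℝ}
    (h : IsTropicalRoots a d α) (ha : ∀ j, 0 ≤ a j) (h0 : 0 < a 0) (i : Fin d) : 0 < α i := by
  refine (h.2.1 i).lt_of_ne fun hi => ?_
  rw [h.coeff_zero ha, Finset.prod_eq_zero (Finset.mem_univ i) hi.symm] at h0
  simp at h0

/-- The tropical roots, numbered from `0`, continued by their last value. -/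
def rootSeq {d : ℕ} (α : Fin d → ℝ) (hd : 0 < d) (i : ℕ) : ℝ :=
  α ⟨min i (d - 1), by omega⟩

lemma rootSeq_val {d : ℕ} (α : Fin d → ℝ) (hd : 0 < d) (i : Fin d) :
    rootSeq α hd i = α i := by
  unfold rootSeq
  congr 1
  ext
  have := i.2
  simp only
  omega

lemma rootSeq_of_lt {d : ℕ} (α : Fin d → ℝ) (hd : 0 < d) {i : ℕ} (hi : i < d) :
    rootSeq α hd i = α ⟨i, hi⟩ := rootSeq_val α hd ⟨i, hi⟩

lemma rootSeq_mono {d : ℕ} {α : Fin d → ℝ} (h : Monotone α) (hd : 0 < d) :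
    Monotone (rootSeq α hd) := fun i j hij => h (by
  simp only [Fin.mk_le_mk]
  omega)

lemma prod_max_eq {d : ℕ} {α : Fin d → ℝ} (hd : 0 < d) {v : ℕ} (hv : v ≤ d) {x : ℝ}
    (h1 : ∀ i : Fin d, i.val < v → α i ≤ x) (h2 : ∀ i : Fin d, v ≤ i.val → x ≤ α i) :
    ∏ i, max x (α i) = x ^ v * ∏ i ∈ Finset.range (d - v), rootSeq α hd (v + i) := by
  have e1 : ∏ i, max x (α i) = ∏ i ∈ Finset.range d, max x (rootSeq α hd i) := by
    rw [← Fin.prod_univ_eq_prod_range (fun i => max x (rootSeq α hd i))]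
    exact Finset.prod_congr rfl fun i _ => by rw [rootSeq_val]
  have e2 := Finset.prod_range_add (fun i => max x (rootSeq α hd i)) v (d - v)
  rw [Nat.add_sub_cancel' hv] at e2
  rw [e1, e2]
  congr 1
  · rw [← Finset.card_range v, ← Finset.prod_const, Finset.card_range]
    refine Finset.prod_congr rfl fun i hi => ?_
    have hi' := Finset.mem_range.1 hi
    rw [rootSeq_of_lt _ _ (show i < d by omega)]
    exact max_eq_left (h1 ⟨i, by omega⟩ hi')
  · refine Finset.prod_congr rfl fun i hi => ?_
    have hi' := Finset.mem_range.1 hi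
    rw [rootSeq_of_lt _ _ (show v + i < d by omega)]
    exact max_eq_right (h2 ⟨v + i, by omega⟩ (Nat.le_add_right _ _))

/-- At x = α_j the factorization reads a_j x^j ≤ a_d x^j α_{j+1}⋯α_d. Cancelling x^j and multiplying
by α_1⋯α_j gives a_d ∏ α_i = a_0 on the right. -/
lemma IsTropicalRoots.coeff_mul_prod_le {a : ℕ → ℝ} {d : ℕ} {α : Fin d → ℝ}
    (h : IsTropicalRoots a d α) (ha : ∀ j, 0 ≤ a j) (h0 : 0 < a 0) (hd : 0 < d)
    {j : ℕ} (hj : j ≤ d) : a j * ∏ i ∈ Finset.range j, rootSeq α hd i ≤ a 0 := by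
  have hpos : ∀ i, 0 < rootSeq α hd i := fun i => h.pos ha h0 _
  have hc : a 0 = a d * ((∏ i ∈ Finset.range j, rootSeq α hd i)
      * ∏ i ∈ Finset.range (d - j), rootSeq α hd (j + i)) := by
    rw [← Finset.prod_range_add, show j + (d - j) = d by omega, h.coeff_zero ha,
      ← Fin.prod_univ_eq_prod_range]
    simp only [rootSeq_val]
  have hP := Finset.prod_pos (s := Finset.range j) fun i _ => hpos i
  have hle : a j ≤ a d * ∏ i ∈ Finset.range (d - j), rootSeq α hd (j + i) := by
    rcases Nat.eq_zero_or_pos j with rfl | hj0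
    · simpa using hc.le
    have hx := hpos (j - 1)
    have h1 := h.mul_pow_le hx.le hj
    rw [prod_max_eq hd hj (x := rootSeq α hd (j - 1))] at h1
    · rw [mul_left_comm, mul_comm (a j)] at h1
      exact le_of_mul_le_mul_left h1 (by positivity)
    · intro i hi
      rw [← rootSeq_val α hd i]
      exact rootSeq_mono h.1 hd (by omega)
    · intro i hi
      rw [← rootSeq_val α hd i]
      exact rootSeq_mono h.1 hd (by omega)
  calc _ ≤ _ := mul_le_mul_of_nonneg_right hle hP.le
    _ = a 0 := by rw [hc]; ring

/-! ### Vertices of the Newton polygon -/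

/-- The linear functional (p₁, p₂) ↦ p₂ + s p₁ exposes the point (v, log a_v) of the hull, and an
exposed point is extreme. -/
lemma mem_newtonVertices_of_strict_max {a : ℕ → ℝ} {d v : ℕ} (hv : v ≤ d) (hav : 0 < a v) {s : ℝ}
    (hs : ∀ j ≤ d, j ≠ v → 0 < a j →
      Real.log (a j) + j * s < Real.log (a v) + v * s) :
    v ∈ newtonVertices a d := by
  classical
  simp only [newtonVertices, Finset.mem_filter, Finset.mem_range]
  refine ⟨by omega, Real.log (a v), ?_⟩
  set pt : ℝ × ℝ := ((v : ℝ), Real.log (a v)) with hpt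
  set M := Real.log (a v) + v * s with hM
  have hptM : pt.2 + pt.1 * s = M := rfl
  -- An open half-plane together with one point of its boundary line is convex.
  have hsub : convexHull ℝ (newtonRegion a d) ⊆ {p | p.2 + p.1 * s < M} ∪ {pt} := by
    refine convexHull_min ?_ ?_
    · rintro p ⟨j, hj, haj, hp1, hp2⟩
      by_cases hjv : j = v
      · subst hjv
        rcases hp2.eq_or_lt with h | h
        · right
          exact Prod.ext hp1 h
        · left
          simp only [Set.mem_ofPred_eq, hp1, hM]
          linarith
      · left
        simp only [Set.mem_ofPred_eq, hp1]
        exact lt_of_le_of_lt (by linarith) (hs j hj hjv haj)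
    · intro p hp q hq t u ht hu htu
      by_cases hpq : p = pt ∧ q = pt
      · right
        rw [hpq.1, hpq.2, ← add_smul, htu, one_smul]
        rfl
      have hle : ∀ r ∈ {p : ℝ × ℝ | p.2 + p.1 * s < M} ∪ {pt}, r.2 + r.1 * s ≤ M := by
        rintro r (hr | hr)
        · exact le_of_lt hr
        · rw [Set.mem_singleton_iff.1 hr, hptM]
      have hlt : ∀ r ∈ {p : ℝ × ℝ | p.2 + p.1 * s < M} ∪ {pt}, r ≠ pt → r.2 + r.1 * s < M := by
        rintro r (hr | hr) hne
        · exact hr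
        · exact absurd hr hne
      rcases ht.eq_or_lt with h | ht'
      · rw [← h, zero_add] at htu
        rwa [← h, htu, zero_smul, one_smul, zero_add]
      rcases hu.eq_or_lt with h | hu'
      · rw [← h, add_zero] at htu
        rwa [← h, htu, zero_smul, one_smul, add_zero]
      left
      have e : (t • p + u • q).2 + (t • p + u • q).1 * s
          = t * (p.2 + p.1 * s) + u * (q.2 + q.1 * s) := by
        simp only [Prod.snd_add, Prod.fst_add, Prod.smul_snd, Prod.smul_fst, smul_eq_mul]; ring
      have eM : M = t * M + u * M := by rw [← add_mul, htu, one_mul]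
      rw [Set.mem_ofPred_eq, e, eM]
      have h1 := hle p hp
      have h2 := hle q hq
      by_cases hp' : p = pt
      · have h3 := hlt q hq fun h => hpq ⟨hp', h⟩
        exact add_lt_add_of_le_of_lt (mul_le_mul_of_nonneg_left h1 ht)
          (mul_lt_mul_of_pos_left h3 hu')
      · have h3 := hlt p hp hp'
        exact add_lt_add_of_lt_of_le (mul_lt_mul_of_pos_left h3 ht')
          (mul_le_mul_of_nonneg_left h2 hu)
  have hfun : ∀ p ∈ convexHull ℝ (newtonRegion a d), p.2 + p.1 * s ≤ M ∧
      (p.2 + p.1 * s = M → p = pt) := by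
    intro p hp
    rcases hsub hp with h | h
    · exact ⟨le_of_lt h, fun h' => absurd h' (ne_of_lt h)⟩
    · exact ⟨by rw [Set.mem_singleton_iff.1 h, hptM], fun _ => h⟩
  rw [mem_extremePoints]
  refine ⟨subset_convexHull ℝ _ ⟨v, hv, hav, rfl, le_rfl⟩, ?_⟩
  rintro p hp q hq ⟨t, u, ht, hu, htu, heq⟩
  have e : t * (p.2 + p.1 * s) + u * (q.2 + q.1 * s) = M := by
    rw [← hptM, ← heq]
    simp only [Prod.snd_add, Prod.fst_add, Prod.smul_snd, Prod.smul_fst, smul_eq_mul]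
    ring
  have eM : M = t * M + u * M := by rw [← add_mul, htu, one_mul]
  obtain ⟨h1, h1'⟩ := hfun p hp
  obtain ⟨h2, h2'⟩ := hfun q hq
  have g1 := mul_le_mul_of_nonneg_left h1 ht.le
  have g2 := mul_le_mul_of_nonneg_left h2 hu.le
  exact ⟨h1' (mul_left_cancel₀ ht.ne' (by linarith)), h2' (mul_left_cancel₀ hu.ne' (by linarith))⟩

/-- Between `lo` and `hi` the tropical polynomial is the single monomial C x^v. A monomial of
another degree touching it at an interior point would exceed it on one side, so degree v alone
attains the maximum there; in logarithmic coordinates this is a strict maximum with slope s = log x.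
-/
lemma IsTropicalRoots.mem_newtonVertices {a : ℕ → ℝ} {d : ℕ} {α : Fin d → ℝ}
    (h : IsTropicalRoots a d α) (hd : 0 < d) (hdpos : 0 < a d)
    {v : ℕ} (hv : v ≤ d) {lo hi : ℝ} (hlo : 0 ≤ lo) (hlohi : lo < hi)
    (h1 : ∀ i : Fin d, i.val < v → α i ≤ lo) (h2 : ∀ i : Fin d, v ≤ i.val → hi ≤ α i) :
    v ∈ newtonVertices a d := by
  set C := a d * ∏ i ∈ Finset.range (d - v), rootSeq α hd (v + i) with hC
  have hval : ∀ x, lo < x → x < hi → tropPoly a d x = C * x ^ v := fun x hx hx' => by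
    rw [h.2.2 x (hlo.trans hx.le), prod_max_eq hd hv (fun i hi => (h1 i hi).trans hx.le)
      fun i hi => hx'.le.trans (h2 i hi), hC]
    ring
  have hle : ∀ x, lo < x → x < hi → ∀ j ≤ d, a j * x ^ j ≤ C * x ^ v := fun x hx hx' j hj => by
    rw [← hval x hx hx']
    exact Finset.le_sup' (fun j => a j * x ^ j) (Finset.mem_range.2 (Nat.lt_succ_of_le hj))
  have hCpos : 0 < C := by
    refine mul_pos hdpos (Finset.prod_pos fun i hi' => ?_)
    have := Finset.mem_range.1 hi'
    rw [rootSeq_of_lt α hd (show v + i < d by omega)]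
    exact (hlo.trans_lt hlohi).trans_le (h2 _ (Nat.le_add_right _ _))
  obtain ⟨x, hx, hx'⟩ := exists_between hlohi
  obtain ⟨y, hy, hy'⟩ := exists_between hx
  obtain ⟨z, hz, hz'⟩ := exists_between hx'
  have hx0 : 0 < x := hlo.trans_lt hx
  have hy0 : 0 < y := hlo.trans_lt hy
  have hz0 : 0 < z := hx0.trans hz
  have huniq : ∀ j ≤ d, a j * x ^ j = C * x ^ v → j = v := by
    intro j hj he
    by_contra hne
    have ht : ∀ t, 0 < t → t * x < hi → lo < t * x → t ^ j ≤ t ^ v := fun t ht ht1 ht2 => by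
      have := hle (t * x) ht2 ht1 j hj
      rw [mul_pow, mul_pow, mul_left_comm, he] at this
      have hp : 0 < C * x ^ v := by positivity
      refine le_of_mul_le_mul_right ?_ hp
      linarith
    rcases lt_or_gt_of_ne hne with hlt | hgt
    · have e : y / x * x = y := by field_simp
      have := ht (y / x) (by positivity) (by rw [e]; linarith) (by rw [e]; exact hy)
      exact absurd this (not_le.2 (pow_lt_pow_right_of_lt_one₀ (by positivity)
        ((div_lt_one hx0).2 hy') hlt))
    · have e : z / x * x = z := by field_simp
      have := ht (z / x) (by positivity) (by rw [e]; exact hz') (by rw [e]; linarith)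
      exact absurd this (not_le.2 (pow_lt_pow_right₀ ((one_lt_div hx0).2 hz) hgt))
  have hav : a v * x ^ v = C * x ^ v := by
    obtain ⟨j, hj, hje⟩ := Finset.exists_mem_eq_sup' (s := Finset.range (d + 1))
      Finset.nonempty_range_add_one (fun j => a j * x ^ j)
    have e : a j * x ^ j = C * x ^ v := by rw [← hval x hx hx']; exact hje.symm
    have := huniq j (Nat.lt_succ_iff.1 (Finset.mem_range.1 hj)) e
    rwa [this] at e
  have havpos : 0 < a v := by
    rw [mul_right_cancel₀ (pow_pos hx0 v).ne' hav]; exact hCpos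
  refine mem_newtonVertices_of_strict_max hv havpos (s := Real.log x) fun j hj hne haj => ?_
  have hlt : a j * x ^ j < a v * x ^ v := by
    rw [hav]
    exact (hle x hx hx' j hj).lt_of_ne fun e => hne (huniq j hj e)
  have := Real.log_lt_log (by positivity) hlt
  rwa [Real.log_mul haj.ne' (by positivity), Real.log_mul havpos.ne' (by positivity),
    Real.log_pow, Real.log_pow] at this

/-! ### Ratios of tropical roots -/

lemma rootSeq_pos {d : ℕ} {α : Fin d → ℝ} (hd : 0 < d) (hpos : ∀ i, 0 < α i) (i : ℕ) :
    0 < rootSeq α hd i := hpos _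

lemma extRoot_of_pos {d : ℕ} (α : Fin d → ℝ) (hd : 0 < d) {j : ℕ} (hj : 1 ≤ j) (hjd : j ≤ d) :
    extRoot α j = ENNReal.ofReal (rootSeq α hd (j - 1)) := by
  rw [extRoot, if_neg (by omega), dif_pos (by omega), rootSeq_of_lt]

lemma ratio_zero_left {d : ℕ} (α : Fin d → ℝ) (j : ℕ) : ratio α 0 j = 0 := by
  simp [ratio, extRoot]

lemma ratio_top_right {d : ℕ} (α : Fin d → ℝ) (i : ℕ) : ratio α i (d + 1) = 0 := by
  simp [ratio, extRoot]

lemma ratio_eq_div {d : ℕ} {α : Fin d → ℝ} (hd : 0 < d) (hpos : ∀ i, 0 < α i) {i j : ℕ}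
    (hi : 1 ≤ i) (hid : i ≤ d) (hj : 1 ≤ j) (hjd : j ≤ d) :
    ratio α i j = rootSeq α hd (i - 1) / rootSeq α hd (j - 1) := by
  have h1 : 0 < rootSeq α hd (i - 1) := hpos _
  have h2 : 0 < rootSeq α hd (j - 1) := hpos _
  rw [ratio, extRoot_of_pos α hd hi hid, extRoot_of_pos α hd hj hjd,
    ← ENNReal.ofReal_div_of_pos h2, ENNReal.toReal_ofReal (by positivity)]

lemma ratio_nonneg {d : ℕ} (α : Fin d → ℝ) (i j : ℕ) : 0 ≤ ratio α i j := ENNReal.toReal_nonneg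

lemma ratio_le_one {d : ℕ} {α : Fin d → ℝ} (hd : 0 < d) (hmono : Monotone α)
    (hpos : ∀ i, 0 < α i) {i j : ℕ} (hij : i ≤ j) (hjd : j ≤ d + 1) : ratio α i j ≤ 1 := by
  rcases Nat.eq_zero_or_pos i with rfl | hi
  · rw [ratio_zero_left]; exact zero_le_one
  rcases hjd.eq_or_lt with rfl | hj
  · rw [ratio_top_right]; exact zero_le_one
  rw [ratio_eq_div hd hpos hi (by omega) (by omega) (by omega)]
  exact div_le_one_of_le₀ (rootSeq_mono hmono hd (by omega)) (hpos _).le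

lemma le_of_mem_newtonVertices {a : ℕ → ℝ} {d v : ℕ} (hv : v ∈ newtonVertices a d) : v ≤ d := by
  classical
  exact Nat.lt_succ_iff.1 (Finset.mem_range.1 (Finset.mem_filter.1 hv).1)

/-- The jump condition is void at v = 0 and v = d, where the roots 0 and ∞ are adjoined. The
converse is not needed: every vertex is an admissible index anyway. -/
lemma mem_newtonVertices_of_lt {a : ℕ → ℝ} {d : ℕ} {α : Fin d → ℝ} (h : IsTropicalRoots a d α)
    (hd : 0 < d) (hpos : ∀ i, 0 < α i) (hdpos : 0 < a d) {v : ℕ} (hv : v ≤ d)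
    (hlt : 0 < v → v < d → rootSeq α hd (v - 1) < rootSeq α hd v) : v ∈ newtonVertices a d := by
  have hm := rootSeq_mono h.1 hd
  rcases Nat.eq_zero_or_pos v with rfl | hv0
  · refine h.mem_newtonVertices hd hdpos hv le_rfl (hpos ⟨0, hd⟩) (fun i hi => absurd hi (by omega))
      fun i _ => h.1 (Fin.mk_le_of_le_val (Nat.zero_le _))
  rcases hv.eq_or_lt with rfl | hvd
  · refine h.mem_newtonVertices hd hdpos le_rfl (lo := rootSeq α hd (v - 1))
      (hi := rootSeq α hd (v - 1) + 1) (hpos _).le (by linarith) (fun i _ => ?_)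
      fun i hi => absurd i.2 (by omega)
    rw [← rootSeq_val α hd]
    exact hm (by omega)
  · refine h.mem_newtonVertices hd hdpos hv (hpos _).le (hlt hv0 hvd) (fun i _ => ?_) fun i hi => ?_
    · rw [← rootSeq_val α hd]
      exact hm (by omega)
    · rw [← rootSeq_val α hd]
      exact hm hi

/-! ### The constants are optimal -/

/-- If v is not a vertex, then α_v = α_{v+1}. So kp = v + 1 can be replaced by v, with the same
ratio and a smaller first argument of `F`; when v = k, the ratio is 1 and `F` vanishes. -/
lemma isGreatest_sup_vertices_above {a : ℕ → ℝ} {d : ℕ} {α : Fin d → ℝ}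
    (h : IsTropicalRoots a d α) (hd : 0 < d) (hpos : ∀ i, 0 < α i) (hdpos : 0 < a d)
    {F : ℕ → ℝ → ℝ≥0∞} (hF : ∀ δ, 0 ≤ δ → Antitone fun m => F m δ) (hF1 : ∀ m, F m 1 = 0)
    {k : ℕ} (hk : 1 ≤ k) (hkd : k ≤ d) :
    IsGreatest {L | ∃ kp, k < kp ∧ kp ≤ d + 1 ∧ L = F (kp - k - 1) (ratio α k kp)}
      (((newtonVertices a d).filter fun v => k ≤ v).sup fun v => F (v - k) (ratio α k (v + 1))) := by
  constructor
  · have hne : ((newtonVertices a d).filter fun v => k ≤ v).Nonempty :=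
      ⟨d, Finset.mem_filter.2 ⟨mem_newtonVertices_of_lt h hd hpos hdpos le_rfl
        fun _ h' => absurd h' (lt_irrefl _), hkd⟩⟩
    obtain ⟨v, hv, he⟩ := Finset.exists_mem_eq_sup _ hne fun v => F (v - k) (ratio α k (v + 1))
    obtain ⟨hv1, hv2⟩ := Finset.mem_filter.1 hv
    have hvd := le_of_mem_newtonVertices hv1
    exact ⟨v + 1, by omega, by omega, by rw [he, show v + 1 - k - 1 = v - k by omega]⟩
  · rintro L ⟨kp, h1, h2, rfl⟩
    obtain ⟨i, rfl⟩ : ∃ i, kp = k + i + 1 := ⟨kp - k - 1, by omega⟩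
    rw [show k + i + 1 - k - 1 = i by omega]
    clear h1
    -- The induction is on i = kp - k - 1, the first argument of `F`.
    induction i with
    | zero =>
      by_cases hmem : k ∈ newtonVertices a d
      · refine le_trans (le_of_eq ?_) (Finset.le_sup (Finset.mem_filter.2 ⟨hmem, le_refl k⟩))
        simp
      · have hge := mt (mem_newtonVertices_of_lt h hd hpos hdpos hkd) hmem
        push Not at hge
        obtain ⟨-, hkd', hle⟩ := hge
        have e := le_antisymm hle (rootSeq_mono h.1 hd (Nat.sub_le k 1))
        rw [ratio_eq_div hd hpos hk hkd (by omega) (by omega), show k + 0 + 1 - 1 = k by omega, e,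
          div_self (rootSeq_pos hd hpos _).ne', hF1]
        exact zero_le
    | succ i ih =>
      by_cases hmem : k + (i + 1) ∈ newtonVertices a d
      · refine le_trans (le_of_eq ?_) (Finset.le_sup (Finset.mem_filter.2 ⟨hmem, by omega⟩))
        rw [Nat.add_sub_cancel_left]
      · have hge := mt (mem_newtonVertices_of_lt h hd hpos hdpos (by omega)) hmem
        push Not at hge
        obtain ⟨-, hkd', hle⟩ := hge
        have e := le_antisymm hle (rootSeq_mono h.1 hd (Nat.sub_le _ 1))
        refine le_trans ?_ (ih (by omega))
        rw [ratio_eq_div hd hpos hk hkd (by omega) (by omega),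
          ratio_eq_div hd hpos hk hkd (by omega) (by omega),
          show k + (i + 1) + 1 - 1 = k + (i + 1) by omega, e,
          show k + (i + 1) - 1 = k + i + 1 - 1 by omega]
        exact hF _ (div_nonneg (hpos _).le (hpos _).le) (Nat.le_succ i)

/-- The same descent, with km now raised towards k. -/
lemma isGreatest_sup_vertices_below {a : ℕ → ℝ} {d : ℕ} {α : Fin d → ℝ}
    (h : IsTropicalRoots a d α) (hd : 0 < d) (hpos : ∀ i, 0 < α i) (hdpos : 0 < a d)
    {F : ℕ → ℝ → ℝ≥0∞} (hF : ∀ δ, 0 ≤ δ → Antitone fun m => F m δ) (hF1 : ∀ m, F m 1 = 0)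
    {k : ℕ} (hk : 1 ≤ k) (hkd : k ≤ d) :
    IsGreatest {L | ∃ km, km < k ∧ L = F (k - km) (ratio α km k)}
      (((newtonVertices a d).filter fun v => v < k).sup fun v => F (k - v) (ratio α v k)) := by
  constructor
  · have hne : ((newtonVertices a d).filter fun v => v < k).Nonempty :=
      ⟨0, Finset.mem_filter.2 ⟨mem_newtonVertices_of_lt h hd hpos hdpos (Nat.zero_le d)
        fun h' => absurd h' (lt_irrefl _), hk⟩⟩
    obtain ⟨v, hv, he⟩ := Finset.exists_mem_eq_sup _ hne fun v => F (k - v) (ratio α v k)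
    exact ⟨v, (Finset.mem_filter.1 hv).2, he⟩
  · rintro L ⟨km, h1, rfl⟩
    obtain ⟨i, hi, rfl⟩ : ∃ i, i + 1 ≤ k ∧ km = k - (i + 1) := ⟨k - km - 1, by omega, by omega⟩
    clear h1
    induction i with
    | zero =>
      by_cases hmem : k - (0 + 1) ∈ newtonVertices a d
      · exact Finset.le_sup (f := fun v => F (k - v) (ratio α v k))
          (Finset.mem_filter.2 ⟨hmem, by omega⟩)
      · have hge := mt (mem_newtonVertices_of_lt h hd hpos hdpos (by omega)) hmem
        push Not at hge
        obtain ⟨hk0, hkd', hle⟩ := hge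
        have e := le_antisymm hle (rootSeq_mono h.1 hd (Nat.sub_le _ 1))
        rw [ratio_eq_div hd hpos (by omega) (by omega) hk hkd, ← e, zero_add,
          div_self (rootSeq_pos hd hpos _).ne', hF1]
        exact zero_le
    | succ i ih =>
      by_cases hmem : k - (i + 1 + 1) ∈ newtonVertices a d
      · exact Finset.le_sup (f := fun v => F (k - v) (ratio α v k))
          (Finset.mem_filter.2 ⟨hmem, by omega⟩)
      · have hge := mt (mem_newtonVertices_of_lt h hd hpos hdpos (by omega)) hmem
        push Not at hge
        obtain ⟨hk0, hkd', hle⟩ := hge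
        have e := le_antisymm hle (rootSeq_mono h.1 hd (Nat.sub_le _ 1))
        refine le_trans ?_ (ih (by omega))
        rw [ratio_eq_div hd hpos (by omega) (by omega) hk hkd,
          ratio_eq_div hd hpos (by omega) (by omega) hk hkd, ← e,
          show k - (i + 1) - 1 = k - (i + 1 + 1) by omega]
        exact hF _ (div_nonneg (hpos _).le (hpos _).le) (by omega)

lemma antitone_one_div_calU {δ : ℝ} (h0 : 0 ≤ δ) : Antitone fun m => 1 / calU m δ :=
  fun _ _ h => ENNReal.div_le_div_left (calU_mono_left h h0) 1

lemma antitone_one_div_sqrt_calU (δ : ℝ) :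
    Antitone fun m => 1 / (calU m (δ ^ 2)) ^ (1 / 2 : ℝ) :=
  fun _ _ h => ENNReal.div_le_div_left
    (ENNReal.rpow_le_rpow (calU_mono_left h (sq_nonneg δ)) (by norm_num)) 1

lemma one_div_sqrt_calU_one (m : ℕ) : 1 / (calU m ((1 : ℝ) ^ 2)) ^ (1 / 2 : ℝ) = 0 := by
  rw [one_pow, calU_one, ENNReal.top_rpow_of_pos (by norm_num), ENNReal.div_top]

lemma sqrt_calU_eq {m : ℕ} {δ : ℝ} (h0 : 0 ≤ δ) (h1 : δ < 1) :
    (calU m (δ ^ 2)) ^ (1 / 2 : ℝ) = ENNReal.ofReal (Real.sqrt (valU m (δ ^ 2))) := by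
  have h2 : δ ^ 2 < 1 := by nlinarith
  rw [calU_eq_valU h2, ENNReal.ofReal_rpow_of_pos (valU_pos (sq_nonneg δ) h2), Real.sqrt_eq_rpow]

lemma sqrt_calU_le_calU {m : ℕ} {δ : ℝ} (h0 : 0 ≤ δ) (h1 : δ ≤ 1) :
    (calU m (δ ^ 2)) ^ (1 / 2 : ℝ) ≤ calU m δ := by
  rcases h1.eq_or_lt with rfl | h1
  · rw [calU_one]; exact le_top
  · rw [sqrt_calU_eq h0 h1, calU_eq_valU h1]
    exact ENNReal.ofReal_le_ofReal
      (Real.sqrt_le_iff.2 ⟨(valU_pos h0 h1).le, valU_sq_le h0 h1⟩)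

lemma LOpt_le_LStarOpt {a : ℕ → ℝ} {d : ℕ} {α : Fin d → ℝ} (hd : 0 < d) (hmono : Monotone α)
    (hpos : ∀ i, 0 < α i) {k : ℕ} (hkd : k ≤ d) : LOpt a α k ≤ LStarOpt a α k := by
  refine max_le_max (Finset.sup_mono_fun fun v hv => ?_) (Finset.sup_mono_fun fun v hv => ?_)
  · obtain ⟨hv1, hv2⟩ := Finset.mem_filter.1 hv
    have hvd := le_of_mem_newtonVertices hv1
    exact ENNReal.div_le_div_left (sqrt_calU_le_calU (ratio_nonneg _ _ _)
      (ratio_le_one hd hmono hpos (by omega) (by omega))) 1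
  · obtain ⟨hv1, hv2⟩ := Finset.mem_filter.1 hv
    exact ENNReal.div_le_div_left (sqrt_calU_le_calU (ratio_nonneg _ _ _)
      (ratio_le_one hd hmono hpos hv2.le (by omega))) 1

/-! ### Hadamard's inequality for the normalized Frobenius norm -/

lemma prod_le_pow_mean {n : ℕ} (hn : 0 < n) {z : Fin n → ℝ} (hz : ∀ i, 0 ≤ z i) :
    ∏ i, z i ≤ ((1 / (n : ℝ)) * ∑ i, z i) ^ n := by
  have hn' : (0 : ℝ) < n := by exact_mod_cast hn
  have h := Real.geom_mean_le_arith_mean Finset.univ (fun _ : Fin n => (1 : ℝ)) z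
    (fun _ _ => zero_le_one) (by simpa using hn') fun i _ => hz i
  simp only [Real.rpow_one, Finset.sum_const, Finset.card_univ, Fintype.card_fin, nsmul_eq_mul,
    mul_one, one_mul] at h
  have hP : 0 ≤ ∏ i, z i := Finset.prod_nonneg fun i _ => hz i
  calc ∏ i, z i = ((∏ i, z i) ^ (n : ℝ)⁻¹) ^ n := by
        rw [Real.rpow_inv_natCast_pow hP hn.ne']
    _ ≤ ((∑ i, z i) / n) ^ n := by
        gcongr
    _ = _ := by rw [div_eq_inv_mul, one_div]

lemma normFrob_sq {n : ℕ} (A : Matrix (Fin n) (Fin n) ℂ) :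
    normFrob A ^ 2 = (1 / (n : ℝ)) * ∑ i, ∑ j, ‖A i j‖ ^ 2 :=
  Real.sq_sqrt (by positivity)

open scoped ComplexOrder in
-- The arithmetic-geometric mean inequality for the eigenvalues of A A*, whose product is |det A|²
-- and whose sum is the squared Frobenius norm.
lemma norm_det_sq_le {n : ℕ} (hn : 0 < n) (A : Matrix (Fin n) (Fin n) ℂ) :
    ‖A.det‖ ^ 2 ≤ (normFrob A ^ 2) ^ n := by
  have hpsd := Matrix.posSemidef_self_mul_conjTranspose A
  have hdet := hpsd.1.det_eq_prod_eigenvalues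
  have htr := hpsd.1.trace_eq_sum_eigenvalues
  have h1 : ‖A.det‖ ^ 2 = ∏ i, hpsd.1.eigenvalues i := by
    rw [Matrix.det_mul, Matrix.det_conjTranspose] at hdet
    have : ((‖A.det‖ ^ 2 : ℝ) : ℂ) = ((∏ i, hpsd.1.eigenvalues i : ℝ) : ℂ) := by
      push_cast
      rw [← Complex.mul_conj']
      exact hdet
    exact_mod_cast this
  have h2 : ∑ i, ∑ j, ‖A i j‖ ^ 2 = ∑ i, hpsd.1.eigenvalues i := by
    have : ((∑ i, ∑ j, ‖A i j‖ ^ 2 : ℝ) : ℂ) = ((∑ i, hpsd.1.eigenvalues i : ℝ) : ℂ) := by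
      push_cast
      refine Eq.trans ?_ htr
      simp only [Matrix.trace, Matrix.diag, Matrix.mul_apply, Matrix.conjTranspose_apply]
      refine Finset.sum_congr rfl fun i _ => Finset.sum_congr rfl fun j _ => ?_
      exact (Complex.mul_conj' _).symm
    exact_mod_cast this
  rw [h1, normFrob_sq, h2]
  exact prod_le_pow_mean hn hpsd.eigenvalues_nonneg

/-! ### Mahler measures -/

/-- Jensen's inequality for log, through the tangent line log t ≤ t/C - 1 + log C: averaging (n/2)
log g over the circle gives at most (n/2) log C. -/
lemma mahlerMeasure_sq_le {q : ℂ[X]} (hq : q ≠ 0) {n : ℕ} (hn : 0 < n) {g : ℂ → ℝ}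
    (hg : Continuous g) (hg0 : ∀ z, 0 ≤ g z) (hle : ∀ z, ‖z‖ = 1 → ‖q.eval z‖ ^ 2 ≤ g z ^ n) {C : ℝ}
    (hC : 0 < C) (havg : Real.circleAverage g 0 1 ≤ C) : q.mahlerMeasure ^ 2 ≤ C ^ n := by
  set f : ℂ → ℝ := fun z => ((n : ℝ) / 2) * (g z / C - 1 + Real.log C) with hf
  have hfc : Continuous f := by fun_prop
  have hpt : ∀ z, ‖z‖ = 1 → q.eval z ≠ 0 → Real.log ‖q.eval z‖ ≤ f z := by
    intro z hz1 hz
    have h1 : 0 < ‖q.eval z‖ ^ 2 := by positivity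
    have hgz : 0 < g z := by
      refine (hg0 z).lt_of_ne fun h => ?_
      have := hle z hz1
      rw [← h, zero_pow hn.ne'] at this
      linarith
    have h2 := Real.log_le_log h1 (hle z hz1)
    rw [Real.log_pow, Real.log_pow] at h2
    have h3 := Real.log_le_sub_one_of_pos (div_pos hgz hC)
    rw [Real.log_div hgz.ne' hC.ne'] at h3
    have h4 : Real.log (g z) ≤ g z / C - 1 + Real.log C := by linarith
    have h5 : (n : ℝ) * Real.log (g z) ≤ n * (g z / C - 1 + Real.log C) := by gcongr
    push_cast at h2
    simp only [hf]
    linarith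
  have hint : CircleIntegrable f 0 1 := hfc.continuousOn.circleIntegrable zero_le_one
  have hlog : q.logMahlerMeasure ≤ Real.circleAverage f 0 1 := by
    rw [Polynomial.logMahlerMeasure_def, Real.circleAverage_def, Real.circleAverage_def,
      smul_eq_mul, smul_eq_mul]
    refine mul_le_mul_of_nonneg_left ?_ (by positivity)
    apply intervalIntegral.integral_mono_ae_restrict (by positivity)
      q.intervalIntegrable_mahlerMeasure hint
    rw [Filter.EventuallyLE, MeasureTheory.ae_restrict_iff' measurableSet_Icc, MeasureTheory.ae_iff]
    -- As log 0 = 0 by convention, the pointwise inequality may fail at zeros of q, hence only at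
    -- finitely many angles. The angle 2π is set aside to make `circleMap` injective.
    refine Set.Finite.measure_zero ?_ MeasureTheory.volume
    refine Set.Finite.of_sdiff (Set.Finite.of_finite_image (f := circleMap 0 1)
      ((Multiset.finite_toSet q.roots).subset ?_) ?_) (Set.finite_singleton (2 * Real.pi))
    · rintro z ⟨θ, ⟨hθ, -⟩, rfl⟩
      have : ¬ (θ ∈ Set.Icc 0 (2 * Real.pi) →
        Real.log ‖q.eval (circleMap 0 1 θ)‖ ≤ f (circleMap 0 1 θ)) := hθ
      refine (Polynomial.mem_roots hq).2 ?_
      by_contra h0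
      exact this fun _ => hpt _ (by simp) h0
    · rintro x ⟨hx, hx'⟩ y ⟨hy, hy'⟩ hxy
      have hx1 : x ∈ Set.Icc 0 (2 * Real.pi) := (Classical.not_imp.1 hx).1
      have hy1 : y ∈ Set.Icc 0 (2 * Real.pi) := (Classical.not_imp.1 hy).1
      have hx2 : x < 2 * Real.pi := lt_of_le_of_ne hx1.2 hx'
      have hy2 : y < 2 * Real.pi := lt_of_le_of_ne hy1.2 hy'
      exact injOn_circleMap_of_abs_sub_le' (a := 0) (b := 2 * Real.pi) one_ne_zero (by linarith)
        ⟨hx1.1, hx2⟩ ⟨hy1.1, hy2⟩ hxy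
  have havgf : Real.circleAverage f 0 1 ≤ ((n : ℝ) / 2) * Real.log C := by
    have e : f = fun z => ((n : ℝ) / (2 * C)) • g z + ((n : ℝ) / 2) * (Real.log C - 1) := by
      ext z
      simp only [hf, smul_eq_mul]
      field_simp
      ring
    have hint1 : CircleIntegrable (fun z => ((n : ℝ) / (2 * C)) • g z) 0 1 :=
      ContinuousOn.circleIntegrable zero_le_one (by fun_prop)
    rw [e, Real.circleAverage_fun_add hint1 (circleIntegrable_const _ _ _),
      Real.circleAverage_fun_smul, Real.circleAverage_const, smul_eq_mul]
    have : (n : ℝ) / (2 * C) * Real.circleAverage g 0 1 ≤ (n : ℝ) / (2 * C) * C := by gcongr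
    have e2 : (n : ℝ) / (2 * C) * C = n / 2 := by field_simp
    rw [e2] at this
    linarith
  have hM := Polynomial.mahlerMeasure_pos_of_ne_zero hq
  rw [Polynomial.logMahlerMeasure_eq_log_MahlerMeasure] at hlog
  rw [← Real.log_le_log_iff (by positivity) (by positivity), Real.log_pow, Real.log_pow]
  push_cast
  linarith

/-- Multiplicativity: each factor rX - z has Mahler measure max(r, |z|). -/
lemma mahlerMeasure_comp_C_mul_X {p : ℂ[X]} {r : ℝ} (hr : 0 < r) :
    (p.comp (Polynomial.C (r : ℂ) * Polynomial.X)).mahlerMeasure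
      = ‖p.leadingCoeff‖ * (p.roots.map fun z => max r ‖z‖).prod := by
  nth_rw 1 [(IsAlgClosed.splits p).eq_prod_roots]
  rw [Polynomial.mul_comp, Polynomial.C_comp, Polynomial.mahlerMeasure_mul,
    Polynomial.mahlerMeasure_const, Polynomial.multiset_prod_comp,
    Polynomial.prod_mahlerMeasure_eq_mahlerMeasure_prod, Multiset.map_map, Multiset.map_map]
  congr 2
  refine Multiset.map_congr rfl fun z _ => ?_
  have h := Polynomial.mahlerMeasure_C_mul_X_add_C (a := (r : ℂ)) (by exact_mod_cast hr.ne') (-z)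
  simp only [Function.comp, Polynomial.sub_comp, Polynomial.X_comp, Polynomial.C_comp]
  rw [sub_eq_add_neg, ← Polynomial.C_neg, h, norm_neg, Complex.norm_real, Real.norm_of_nonneg hr.le]

lemma prod_map_nonneg {s : Multiset ℂ} {f : ℂ → ℝ} (hf : ∀ z, 0 ≤ f z) :
    0 ≤ (s.map f).prod :=
  Multiset.prod_nonneg fun x hx => by
    obtain ⟨z, -, rfl⟩ := Multiset.mem_map.1 hx
    exact hf z

lemma pow_card_le_prod_map_max (S : Multiset ℂ) {r : ℝ} (hr : 0 < r) :
    r ^ Multiset.card S ≤ (S.map fun z => max r ‖z‖).prod := by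
  have h := Multiset.prod_map_le_prod_map₀ (s := S) (fun _ => r) (fun z => max r ‖z‖)
    (fun _ _ => hr.le) fun z _ => le_max_left _ _
  simpa using h

/-- A consequence of Jensen's formula: a lower bound for the product of some of the roots. -/
lemma norm_coeff_zero_mul_pow_le {p : ℂ[X]} {r : ℝ} (hr : 0 < r) {S : Multiset ℂ}
    (hS : S ≤ p.roots) :
    ‖p.coeff 0‖ * r ^ Multiset.card S
      ≤ (p.comp (Polynomial.C (r : ℂ) * Polynomial.X)).mahlerMeasure
        * (S.map fun z => ‖z‖).prod := by
  obtain ⟨T, hT⟩ := Multiset.le_iff_exists_add.1 hS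
  have hnorm : ‖p.coeff 0‖ = ‖p.leadingCoeff‖ * (p.roots.map fun z => ‖z‖).prod := by
    rw [(IsAlgClosed.splits p).coeff_zero_eq_leadingCoeff_mul_prod_roots]
    simp only [norm_mul, norm_pow, norm_neg, norm_one, one_pow, one_mul]
    congr 1
    exact (Multiset.prod_hom p.roots (normHom : ℂ →*₀ ℝ)).symm
  rw [mahlerMeasure_comp_C_mul_X hr, hnorm, hT, Multiset.map_add, Multiset.map_add,
    Multiset.prod_add, Multiset.prod_add]
  -- Each factor max(r, |z|) is bounded below by r for the roots in S and by |z| for the others.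
  have h1 : r ^ Multiset.card S ≤ (S.map fun z => max r ‖z‖).prod := pow_card_le_prod_map_max S hr
  have h2 : (T.map fun z => ‖z‖).prod ≤ (T.map fun z => max r ‖z‖).prod :=
    Multiset.prod_map_le_prod_map₀ _ _ (fun z _ => norm_nonneg z) fun z _ => le_max_right _ _
  have h3 : 0 ≤ (S.map fun z => ‖z‖).prod := prod_map_nonneg fun z => norm_nonneg z
  have h4 : 0 ≤ (T.map fun z => ‖z‖).prod := prod_map_nonneg fun z => norm_nonneg z
  have h5 : 0 ≤ (S.map fun z => max r ‖z‖).prod :=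
    prod_map_nonneg fun z => hr.le.trans (le_max_left _ _)
  calc _ = ‖p.leadingCoeff‖ * (S.map fun z => ‖z‖).prod
        * (r ^ Multiset.card S * (T.map fun z => ‖z‖).prod) := by ring
    _ ≤ ‖p.leadingCoeff‖ * (S.map fun z => ‖z‖).prod
        * ((S.map fun z => max r ‖z‖).prod * (T.map fun z => max r ‖z‖).prod) := by gcongr
    _ = _ := by ring

/-! ### Bounds for the determinant of a matrix polynomial -/

lemma eval_detPoly {n : ℕ} (P : (Matrix (Fin n) (Fin n) ℂ)[X]) (w : ℂ) :
    (detPoly P).eval w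
      = (∑ k ∈ Finset.range (P.natDegree + 1), w ^ k • P.coeff k).det := by
  rw [detPoly, ← Polynomial.coe_evalRingHom, RingHom.map_det]
  congr 1
  ext i j
  rw [RingHom.mapMatrix_apply, Matrix.map_apply, Polynomial.coe_evalRingHom,
    Polynomial.eval_eq_sum_range' (n := P.natDegree + 1), Matrix.sum_apply]
  · refine Finset.sum_congr rfl fun k _ => ?_
    rw [matPolyEquiv_symm_apply_coeff, Matrix.smul_apply, smul_eq_mul, mul_comm]
  · rw [Nat.lt_succ_iff, Polynomial.natDegree_le_iff_coeff_eq_zero]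
    intro k hk
    rw [matPolyEquiv_symm_apply_coeff, Polynomial.coeff_eq_zero_of_natDegree_lt hk]
    rfl

lemma detPoly_coeff_zero {n : ℕ} (P : (Matrix (Fin n) (Fin n) ℂ)[X]) :
    (detPoly P).coeff 0 = (P.coeff 0).det := by
  rw [Polynomial.coeff_zero_eq_eval_zero, eval_detPoly, Finset.sum_range_succ']
  simp

lemma circleAverage_norm_sq_poly (c : ℕ → ℂ) (d : ℕ) :
    Real.circleAverage (fun z => ‖∑ k ∈ Finset.range (d + 1), c k * z ^ k‖ ^ 2) 0 1
      = ∑ k ∈ Finset.range (d + 1), ‖c k‖ ^ 2 := by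
  set p : ℂ[X] := ∑ k ∈ Finset.range (d + 1), Polynomial.C (c k) * Polynomial.X ^ k with hp
  have hcoeff : ∀ k, p.coeff k = if k < d + 1 then c k else 0 := fun k => by
    simp [hp, Polynomial.finsetSum_coeff, Polynomial.coeff_C_mul, Polynomial.coeff_X_pow]
  have heval : ∀ z, p.eval z = ∑ k ∈ Finset.range (d + 1), c k * z ^ k := fun z => by
    simp [hp, Polynomial.eval_finsetSum]
  have h := p.sum_sq_norm_coeff_eq_circleAverage
  simp only [heval] at h
  rw [← h]
  refine (Finset.sum_subset (fun k hk => ?_) fun k _ hk => ?_).trans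
    (Finset.sum_congr rfl fun k hk => ?_)
  · rw [Polynomial.mem_support_iff, hcoeff] at hk
    by_contra hk'
    exact hk (if_neg (by simpa using hk'))
  · rw [Polynomial.notMem_support_iff.1 hk]; simp
  · rw [hcoeff, if_pos (Finset.mem_range.1 hk)]

section Assumptions

variable {n : ℕ} {N : Seminorm ℂ (Matrix (Fin n) (Fin n) ℂ)}
  {P : (Matrix (Fin n) (Fin n) ℂ)[X]}

lemma eval_comp_detPoly (P : (Matrix (Fin n) (Fin n) ℂ)[X]) (r : ℝ) (z : ℂ) :
    ((detPoly P).comp (Polynomial.C (r : ℂ) * Polynomial.X)).eval z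
      = (∑ k ∈ Finset.range (P.natDegree + 1), ((r : ℂ) * z) ^ k • P.coeff k).det := by
  simp [Polynomial.eval_comp, eval_detPoly]

lemma comp_detPoly_ne_zero (hP : (P.coeff 0).det ≠ 0) (r : ℝ) :
    (detPoly P).comp (Polynomial.C (r : ℂ) * Polynomial.X) ≠ 0 := by
  intro h
  have h1 := eval_comp_detPoly P r 0
  rw [h, Polynomial.eval_zero, mul_zero, ← eval_detPoly, ← Polynomial.coeff_zero_eq_eval_zero,
    detPoly_coeff_zero] at h1
  exact hP h1.symm

/-- On |z| = 1 the triangle inequality bounds the norm of P(rz) by s, so a constant `g` suffices. -/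
lemma mahlerMeasure_le_of_assumptionOne (hn : 0 < n) (hN : AssumptionOne N)
    (hP : (P.coeff 0).det ≠ 0) (h0 : 0 < N (P.coeff 0)) {r : ℝ} (hr : 0 < r) :
    ((detPoly P).comp (Polynomial.C (r : ℂ) * Polynomial.X)).mahlerMeasure
      ≤ (∑ k ∈ Finset.range (P.natDegree + 1), N (P.coeff k) * r ^ k) ^ n := by
  set s := ∑ k ∈ Finset.range (P.natDegree + 1), N (P.coeff k) * r ^ k with hs
  have hterm : ∀ k ∈ Finset.range (P.natDegree + 1), 0 ≤ N (P.coeff k) * r ^ k := fun k _ =>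
    mul_nonneg (apply_nonneg N _) (pow_nonneg hr.le k)
  have hspos : 0 < s := Finset.sum_pos' hterm ⟨0, by simp, by simpa using h0⟩
  have e : (s ^ 2) ^ n = (s ^ n) ^ 2 := by rw [← pow_mul, mul_comm 2 n, pow_mul]
  have h := mahlerMeasure_sq_le (comp_detPoly_ne_zero hP r) hn (g := fun _ => s ^ 2)
    continuous_const (fun _ => sq_nonneg s) (fun z hz => ?_) (C := s ^ 2) (by positivity)
    (Real.circleAverage_const _ _ _).le
  · rw [e] at h
    exact (pow_le_pow_iff_left₀ (Polynomial.mahlerMeasure_nonneg _) (by positivity)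
      two_ne_zero).1 h
  · rw [eval_comp_detPoly, e]
    have h1 : N (∑ k ∈ Finset.range (P.natDegree + 1), ((r : ℂ) * z) ^ k • P.coeff k) ≤ s := by
      refine (Finset.le_sum_of_subadditive N (map_zero N).le (map_add_le_add N) _ _).trans
        (Finset.sum_le_sum fun k _ => ?_)
      rw [map_smul_eq_mul, norm_pow, norm_mul, hz, mul_one, Complex.norm_real,
        Real.norm_of_nonneg hr.le, mul_comm]
    have h2 := apply_nonneg N (∑ k ∈ Finset.range (P.natDegree + 1), ((r : ℂ) * z) ^ k • P.coeff k)
    have h3 := (hN _).trans (pow_le_pow_left₀ h2 h1 n)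
    gcongr

/-- Multiplication by Q and Q' leaves det P(rz) unchanged. The squared normalized Frobenius norm of
Q P(rz) Q' is averaged entrywise by Parseval, which removes the cross terms: this replaces the
square of a sum by a sum of squares. -/
lemma mahlerMeasure_sq_le_of_assumptionTwo (hn : 0 < n) (hN : AssumptionTwo N)
    (hP : (P.coeff 0).det ≠ 0) (h0 : 0 < N (P.coeff 0)) {r : ℝ} (hr : 0 < r) :
    ((detPoly P).comp (Polynomial.C (r : ℂ) * Polynomial.X)).mahlerMeasure ^ 2
      ≤ (∑ k ∈ Finset.range (P.natDegree + 1), N (P.coeff k) ^ 2 * (r ^ 2) ^ k) ^ n := by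
  obtain ⟨Q, Q', hQ, hQ', hle⟩ := hN
  have hspos : 0 < ∑ k ∈ Finset.range (P.natDegree + 1), N (P.coeff k) ^ 2 * (r ^ 2) ^ k :=
    Finset.sum_pos' (fun k _ => by positivity) ⟨0, by simp, by simpa using pow_pos h0 2⟩
  set c : Fin n → Fin n → ℕ → ℂ := fun i j k => (r : ℂ) ^ k * (Q * P.coeff k * Q') i j with hc
  set g : ℂ → ℝ := fun z => (1 / (n : ℝ)) *
    ∑ i, ∑ j, ‖∑ k ∈ Finset.range (P.natDegree + 1), c i j k * z ^ k‖ ^ 2 with hg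
  have hgeq : ∀ z, g z = normFrob (Q * (∑ k ∈ Finset.range (P.natDegree + 1),
      ((r : ℂ) * z) ^ k • P.coeff k) * Q') ^ 2 := fun z => by
    rw [normFrob_sq]
    refine congrArg (fun t : ℝ => 1 / (n : ℝ) * t) ?_
    refine Finset.sum_congr rfl fun i _ => Finset.sum_congr rfl fun j _ => ?_
    rw [Finset.mul_sum, Finset.sum_mul, Matrix.sum_apply]
    refine congrArg (fun t : ℂ => ‖t‖ ^ 2) (Finset.sum_congr rfl fun k _ => ?_)
    rw [Matrix.mul_smul, Matrix.smul_mul, Matrix.smul_apply, smul_eq_mul, mul_pow]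
    simp only [hc]
    ring
  refine mahlerMeasure_sq_le (comp_detPoly_ne_zero hP r) hn (g := g) (by fun_prop)
    (fun z => by rw [hgeq]; positivity) (fun z _ => ?_) hspos ?_
  · rw [eval_comp_detPoly, hgeq]
    refine le_of_eq_of_le ?_ (norm_det_sq_le hn _)
    rw [Matrix.det_mul, Matrix.det_mul, hQ, hQ', one_mul, mul_one]
  · have hci : ∀ i j, Continuous fun z : ℂ =>
        ‖∑ k ∈ Finset.range (P.natDegree + 1), c i j k * z ^ k‖ ^ 2 := fun i j => by fun_prop
    have havg : Real.circleAverage g 0 1 = (1 / (n : ℝ)) *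
        ∑ i, ∑ j, ∑ k ∈ Finset.range (P.natDegree + 1), ‖c i j k‖ ^ 2 := by
      simp only [hg, ← smul_eq_mul (1 / (n : ℝ))]
      rw [Real.circleAverage_fun_smul, Real.circleAverage_fun_sum fun i _ =>
        (continuous_finsetSum _ fun j _ => hci i j).continuousOn.circleIntegrable zero_le_one]
      congr 1
      refine Finset.sum_congr rfl fun i _ => ?_
      rw [Real.circleAverage_fun_sum fun j _ =>
        (hci i j).continuousOn.circleIntegrable zero_le_one]
      exact Finset.sum_congr rfl fun j _ => circleAverage_norm_sq_poly _ _
    have hsum : (1 / (n : ℝ)) * ∑ i, ∑ j, ∑ k ∈ Finset.range (P.natDegree + 1), ‖c i j k‖ ^ 2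
        = ∑ k ∈ Finset.range (P.natDegree + 1),
          normFrob (Q * P.coeff k * Q') ^ 2 * (r ^ 2) ^ k := by
      have e1 : ∀ i, ∑ j, ∑ k ∈ Finset.range (P.natDegree + 1), ‖c i j k‖ ^ 2
          = ∑ k ∈ Finset.range (P.natDegree + 1), ∑ j, ‖c i j k‖ ^ 2 := fun i => Finset.sum_comm
      simp only [e1]
      rw [Finset.sum_comm, Finset.mul_sum]
      refine Finset.sum_congr rfl fun k _ => ?_
      rw [normFrob_sq, mul_assoc, Finset.sum_mul]
      congr 1
      refine Finset.sum_congr rfl fun i _ => ?_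
      rw [Finset.sum_mul]
      refine Finset.sum_congr rfl fun j _ => ?_
      rw [hc, norm_mul, mul_pow, norm_pow, Complex.norm_real, Real.norm_of_nonneg hr.le]
      ring
    rw [havg, hsum]
    refine Finset.sum_le_sum fun k _ => ?_
    have := hle (P.coeff k)
    have : 0 ≤ normFrob (Q * P.coeff k * Q') := Real.sqrt_nonneg _
    gcongr

end Assumptions

/-! ### Bounds for the gap constant -/

/-- Weights and roots are kept abstract so as to cover both the norms with the tropical roots and
the squares of both. -/
lemma le_valU_of_roots_above {β w : ℕ → ℝ} (hβ : ∀ i, 0 < β i) (hmono : Monotone β) {k v d : ℕ}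
    (hw0 : 0 < w 0) (hw : ∀ j ≤ d, w j * ∏ i ∈ Finset.range j, β i ≤ w 0) {B : ℝ}
    (hB : ∀ R, 0 < R → B * w 0 * R ^ k ≤
      (∑ j ∈ Finset.range (d + 1), w j * R ^ j) * ∏ i ∈ Finset.range k, β i)
    (hk : 1 ≤ k) (hkv : k ≤ v) (hvd : v ≤ d) {δ : ℝ} (h0 : 0 ≤ δ) (h1 : δ < 1)
    (hδ : v < d → β (k - 1) ≤ δ * β v) : B ≤ valU (v - k) δ := by
  refine le_valU_of_forall_le h0 h1 fun x hx hxd => ?_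
  have hR : 0 < x * β (k - 1) := mul_pos (by linarith) (hβ _)
  refine (le_sum_relTerm hβ hw0 hw hR (hB _ hR)).trans
    (sum_relTerm_le_of_roots_above hβ hmono hk (by omega) h0 (fun h => ?_) hx hxd)
  rw [Nat.add_sub_cancel' hkv] at h ⊢
  exact hδ h

lemma le_valU_of_roots_below {β w : ℕ → ℝ} (hβ : ∀ i, 0 < β i) (hmono : Monotone β) {k v d : ℕ}
    (hw0 : 0 < w 0) (hw : ∀ j ≤ d, w j * ∏ i ∈ Finset.range j, β i ≤ w 0) {B : ℝ}
    (hB : ∀ R, 0 < R → B * w 0 * R ^ k ≤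
      (∑ j ∈ Finset.range (d + 1), w j * R ^ j) * ∏ i ∈ Finset.range k, β i)
    (hkd : k ≤ d) (hvk : v < k) {δ : ℝ} (h0 : 0 ≤ δ) (h1 : δ < 1)
    (hδ : 0 < v → β (v - 1) ≤ δ * β (k - 1)) : B ≤ valU (k - v) δ := by
  refine le_valU_of_forall_le h0 h1 fun x hx hxd => ?_
  have hR : 0 < β (k - 1) / x := div_pos (hβ _) (by linarith)
  refine (le_sum_relTerm hβ hw0 hw hR (hB _ hR)).trans
    (sum_relTerm_le_of_roots_below hβ hmono hkd (by omega) h0 (fun h => ?_) hx hxd)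
  rw [Nat.sub_sub_self hvk.le]
  exact hδ (by omega)

/-! ### The product of the smallest eigenvalues -/

lemma eigenvalue_ne_zero {n : ℕ} {P : (Matrix (Fin n) (Fin n) ℂ)[X]}
    (hP : (P.coeff 0).det ≠ 0) {ζ : Fin (n * P.natDegree) → OnePoint ℂ}
    (hζ : IsEigenvalueList P ζ) (i : Fin (n * P.natDegree)) : modulus (ζ i) ≠ 0 := by
  have hmem : ζ i ∈ eigenvalues P := by
    rw [← hζ.1]
    exact Multiset.mem_map_of_mem ζ (Finset.mem_univ i)
  rcases Multiset.mem_add.1 hmem with h | h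
  · obtain ⟨z, hz, hzi⟩ := Multiset.mem_map.1 h
    rw [← hzi]
    intro h0
    have hz0 : z = 0 := by
      have : ENNReal.ofReal ‖z‖ = 0 := h0
      simpa using this
    rw [hz0] at hz
    have := Polynomial.isRoot_of_mem_roots hz
    rw [Polynomial.IsRoot.def, ← Polynomial.coeff_zero_eq_eval_zero, detPoly_coeff_zero] at this
    exact hP this
  · rw [Multiset.eq_of_mem_replicate h]
    exact ENNReal.top_ne_zero

/-- Either some of the first `m` eigenvalues is infinite, or they are roots of `det P`. -/
lemma prod_modulus_eq_top_or {n : ℕ} {P : (Matrix (Fin n) (Fin n) ℂ)[X]}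
    (hP : (P.coeff 0).det ≠ 0) {ζ : Fin (n * P.natDegree) → OnePoint ℂ}
    (hζ : IsEigenvalueList P ζ) {m : ℕ} (hm : m ≤ n * P.natDegree) :
    ∏ i with i.val < m, modulus (ζ i) = ⊤ ∨
      ∃ S ≤ (detPoly P).roots, Multiset.card S = m ∧
        ∏ i with i.val < m, modulus (ζ i) = ENNReal.ofReal (S.map fun z => ‖z‖).prod := by
  by_cases hinf : ∃ i : Fin (n * P.natDegree), i.val < m ∧ ζ i = OnePoint.infty
  · left
    obtain ⟨i, hi, hinf⟩ := hinf
    rw [← Finset.mul_prod_erase _ _ (Finset.mem_filter.2 ⟨Finset.mem_univ i, hi⟩), hinf]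
    exact ENNReal.top_mul (Finset.prod_ne_zero_iff.2 fun j _ => eigenvalue_ne_zero hP hζ j)
  · right
    push Not at hinf
    have hz : ∀ i : Fin (n * P.natDegree), ∃ z : ℂ, i.val < m → ζ i = (z : OnePoint ℂ) := by
      intro i
      by_cases hi : i.val < m
      · obtain ⟨z, hz⟩ := OnePoint.ne_infty_iff_exists.1 (hinf i hi)
        exact ⟨z, fun _ => hz.symm⟩
      · exact ⟨0, fun h => absurd h hi⟩
    choose z hz using hz
    set s : Finset (Fin (n * P.natDegree)) := {i | i.val < m} with hs
    have hmap : (s.val.map z).map (fun w : ℂ => (w : OnePoint ℂ)) = s.val.map ζ := by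
      rw [Multiset.map_map]
      exact Multiset.map_congr rfl fun i hi =>
        (hz i (Finset.mem_filter.1 (Finset.mem_def.2 hi)).2).symm
    refine ⟨s.val.map z, ?_, ?_, ?_⟩
    · have hle : s.val.map ζ ≤ eigenvalues P := by
        rw [← hζ.1]
        exact Multiset.map_le_map (Finset.val_le_iff.2 (Finset.subset_univ s))
      rw [← hmap] at hle
      -- Discarding the copies of ∞ turns the inclusion among eigenvalues into an inclusion among
      -- roots of det P.
      have hf := Multiset.filterMap_le_filterMap
        (fun w : OnePoint ℂ => w.elim none fun u : ℂ => some u) hle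
      have hcoe : ∀ t : Multiset ℂ,
          Multiset.filterMap (fun w : OnePoint ℂ => w.elim none fun u : ℂ => some u)
            (t.map fun w : ℂ => (w : OnePoint ℂ)) = t := fun t => by
        rw [Multiset.filterMap_map]
        exact Multiset.filterMap_some t
      have hrep : ∀ l : ℕ, Multiset.filterMap (fun w : OnePoint ℂ => w.elim none fun u : ℂ => some u)
          (Multiset.replicate l OnePoint.infty) = 0 := fun l => by
        induction l with
        | zero => rfl
        | succ l ih => rw [Multiset.replicate_succ, Multiset.filterMap_cons_none _ _ rfl, ih]
      rwa [eigenvalues, Multiset.filterMap_add, hcoe, hcoe, hrep, add_zero] at hf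
    · rw [Multiset.card_map, Finset.card_val, hs, Fin.card_filter_val_lt, min_eq_right hm]
    · rw [Multiset.map_map]
      change _ = ENNReal.ofReal (∏ i ∈ s, ‖z i‖)
      rw [ENNReal.ofReal_prod_of_nonneg fun i _ => norm_nonneg _]
      refine Finset.prod_congr rfl fun i hi => ?_
      rw [hz i (Finset.mem_filter.1 hi).2]
      rfl

lemma prod_roots_eq {d : ℕ} {α : Fin d → ℝ} (hd : 0 < d) (hpos : ∀ i, 0 < α i) {k : ℕ}
    (hkd : k ≤ d) : ∏ j with j.val < k, ENNReal.ofReal (α j)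
      = ENNReal.ofReal (∏ i ∈ Finset.range k, rootSeq α hd i) := by
  rw [ENNReal.ofReal_prod_of_nonneg fun i _ => (rootSeq_pos hd hpos i).le, Finset.prod_filter]
  have h := Fin.prod_univ_eq_prod_range
    (fun i => if i < k then ENNReal.ofReal (rootSeq α hd i) else 1) d
  simp only [rootSeq_val] at h
  rw [h, ← Finset.prod_filter]
  refine Finset.prod_congr ?_ fun _ _ => rfl
  ext i
  simp only [Finset.mem_filter, Finset.mem_range]
  omega

/-- By the definition of B, the inequality B ≤ u is the master bound with L = 1/u. -/
lemma ofReal_mul_inv_pow_le {n : ℕ} {c u B Z b : ℝ} (hc : 0 ≤ c) (hB : 0 ≤ B) (hu : 0 < u)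
    (hZ : 0 < Z) (hb : 0 < b) (hBn : B ^ n = c * b ^ n / Z) (hBu : B ≤ u) :
    ENNReal.ofReal c * (1 / ENNReal.ofReal u) ^ n ≤ ENNReal.ofReal Z / ENNReal.ofReal b ^ n := by
  have h1 : c * b ^ n / Z ≤ u ^ n := hBn ▸ pow_le_pow_left₀ hB hBu n
  have h2 : c * (1 / u) ^ n ≤ Z / b ^ n := by
    rw [div_pow, one_pow, mul_one_div, div_le_div_iff₀ (by positivity) (by positivity)]
    rwa [div_le_iff₀ hZ, mul_comm (u ^ n)] at h1
  rw [← ENNReal.ofReal_one, ← ENNReal.ofReal_div_of_pos hu, ← ENNReal.ofReal_pow (by positivity),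
    ← ENNReal.ofReal_pow hb.le, ← ENNReal.ofReal_mul hc, ← ENNReal.ofReal_div_of_pos (by positivity)]
  exact ENNReal.ofReal_le_ofReal h2

lemma mul_sup_pow_le {ι : Type*} {n : ℕ} (hn : 0 < n) {c T : ℝ≥0∞} {s : Finset ι} {f : ι → ℝ≥0∞}
    (h : ∀ v ∈ s, c * f v ^ n ≤ T) : c * s.sup f ^ n ≤ T := by
  rcases s.eq_empty_or_nonempty with rfl | hs
  · simp [hn.ne']
  · obtain ⟨v, hv, he⟩ := Finset.exists_mem_eq_sup s hs f
    rw [he]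
    exact h v hv

lemma mul_max_pow_le {n : ℕ} {c T x y : ℝ≥0∞} (hx : c * x ^ n ≤ T) (hy : c * y ^ n ≤ T) :
    c * max x y ^ n ≤ T := by
  rcases max_choice x y with h | h <;> rw [h] <;> assumption

/-! ### The two bounds -/

section Bounds

variable {n : ℕ} {N : Seminorm ℂ (Matrix (Fin n) (Fin n) ℂ)} {P : (Matrix (Fin n) (Fin n) ℂ)[X]}
  {a : ℕ → ℝ} {α : Fin P.natDegree → ℝ} {k : ℕ}

lemma rootSeq_pred_eq_ratio_mul_above {d : ℕ} {α : Fin d → ℝ} (hd : 0 < d) (hpos : ∀ i, 0 < α i) {k v : ℕ}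
    (hk : 1 ≤ k) (hkd : k ≤ d) (hv : v < d) :
    rootSeq α hd (k - 1) = ratio α k (v + 1) * rootSeq α hd v := by
  rw [ratio_eq_div hd hpos hk hkd (by omega) (by omega), Nat.add_sub_cancel,
    div_mul_cancel₀ _ (rootSeq_pos hd hpos v).ne']

lemma rootSeq_pred_eq_ratio_mul_below {d : ℕ} {α : Fin d → ℝ} (hd : 0 < d) (hpos : ∀ i, 0 < α i) {k v : ℕ}
    (hk : v < k) (hkd : k ≤ d) (hv : 0 < v) :
    rootSeq α hd (v - 1) = ratio α v k * rootSeq α hd (k - 1) := by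
  rw [ratio_eq_div hd hpos hv (by omega) (by omega) hkd,
    div_mul_cancel₀ _ (rootSeq_pos hd hpos _).ne']

/-- The master bound for `L = LOpt`, from estimates of the scalar gap constant `B`. -/
lemma mul_LOpt_pow_le {d : ℕ} {α : Fin d → ℝ} (hα : IsTropicalRoots a d α)
    (ha : ∀ j, 0 ≤ a j) (ha0 : 0 < a 0) (hd : 0 < d) (hk : 1 ≤ k) (hkd : k ≤ d) (hn : 0 < n)
    {c B Z : ℝ} (hc : 0 ≤ c) (hB : 0 ≤ B) (hZ : 0 < Z)
    (hBn : B ^ n = c * (∏ i ∈ Finset.range k, rootSeq α hd i) ^ n / Z)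
    (hBR : ∀ R, 0 < R → B * a 0 * R ^ k ≤
      (∑ j ∈ Finset.range (d + 1), a j * R ^ j) * ∏ i ∈ Finset.range k, rootSeq α hd i) :
    ENNReal.ofReal c * LOpt a α k ^ n
      ≤ ENNReal.ofReal Z / ENNReal.ofReal (∏ i ∈ Finset.range k, rootSeq α hd i) ^ n := by
  have hpos := hα.pos ha ha0
  have hβ := rootSeq_pos hd hpos
  have hmono := rootSeq_mono hα.1 hd
  have hb := Finset.prod_pos (s := Finset.range k) fun i _ => hβ i
  have hw := fun j hj => hα.coeff_mul_prod_le ha ha0 hd (j := j) hj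
  have key : ∀ m δ, 0 ≤ δ → δ ≤ 1 → (δ < 1 → B ≤ valU m δ) →
      ENNReal.ofReal c * (1 / calU m δ) ^ n
        ≤ ENNReal.ofReal Z / ENNReal.ofReal (∏ i ∈ Finset.range k, rootSeq α hd i) ^ n := by
    intro m δ h0 h1 h
    -- For δ = 1 the constant is 1/∞ = 0 and the bound is trivial.
    rcases h1.eq_or_lt with rfl | h1
    · simp [calU_one, hn.ne']
    · rw [calU_eq_valU h1]
      exact ofReal_mul_inv_pow_le hc hB (valU_pos h0 h1) hZ hb hBn (h h1)
  refine mul_max_pow_le (mul_sup_pow_le hn fun v hv => ?_) (mul_sup_pow_le hn fun v hv => ?_)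
  · obtain ⟨hv1, hv2⟩ := Finset.mem_filter.1 hv
    have hvd := le_of_mem_newtonVertices hv1
    have h0 := ratio_nonneg α k (v + 1)
    exact key _ _ h0 (ratio_le_one hd hα.1 hpos (by omega) (by omega)) fun h1 =>
      le_valU_of_roots_above hβ hmono ha0 hw hBR hk hv2 hvd h0 h1 fun h =>
        (rootSeq_pred_eq_ratio_mul_above hd hpos hk hkd h).le
  · obtain ⟨hv1, hv2⟩ := Finset.mem_filter.1 hv
    have h0 := ratio_nonneg α v k
    exact key _ _ h0 (ratio_le_one hd hα.1 hpos hv2.le (by omega)) fun h1 =>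
      le_valU_of_roots_below hβ hmono ha0 hw hBR hkd hv2 h0 h1 fun h =>
        (rootSeq_pred_eq_ratio_mul_below hd hpos hv2 hkd h).le

/-- The master bound for `L = LStarOpt`, from estimates of the scalar gap constant `B`. -/
lemma mul_LStarOpt_pow_le {d : ℕ} {α : Fin d → ℝ} (hα : IsTropicalRoots a d α)
    (ha : ∀ j, 0 ≤ a j) (ha0 : 0 < a 0) (hd : 0 < d) (hk : 1 ≤ k) (hkd : k ≤ d) (hn : 0 < n)
    {c B Z : ℝ} (hc : 0 ≤ c) (hB : 0 ≤ B) (hZ : 0 < Z)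
    (hBn : B ^ n = c * (∏ i ∈ Finset.range k, rootSeq α hd i) ^ n / Z)
    (hBR : ∀ R, 0 < R → B ^ 2 * a 0 ^ 2 * R ^ k ≤
      (∑ j ∈ Finset.range (d + 1), a j ^ 2 * R ^ j)
        * (∏ i ∈ Finset.range k, rootSeq α hd i) ^ 2) :
    ENNReal.ofReal c * LStarOpt a α k ^ n
      ≤ ENNReal.ofReal Z / ENNReal.ofReal (∏ i ∈ Finset.range k, rootSeq α hd i) ^ n := by
  have hpos := hα.pos ha ha0
  have hβ := rootSeq_pos hd hpos
  have hmono := rootSeq_mono hα.1 hd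
  have hb := Finset.prod_pos (s := Finset.range k) fun i _ => hβ i
  -- The scalar estimate is applied to the squared coefficients and roots, with B² in place of B.
  have hβ2 : ∀ i, 0 < rootSeq α hd i ^ 2 := fun i => pow_pos (hβ i) 2
  have hmono2 : Monotone fun i => rootSeq α hd i ^ 2 := fun i j hij =>
    pow_le_pow_left₀ (hβ i).le (hmono hij) 2
  have hw : ∀ j ≤ d, a j ^ 2 * ∏ i ∈ Finset.range j, rootSeq α hd i ^ 2 ≤ a 0 ^ 2 := by
    intro j hj
    rw [Finset.prod_pow, ← mul_pow]
    exact pow_le_pow_left₀ (mul_nonneg (ha j) (Finset.prod_nonneg fun i _ => (hβ i).le))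
      (hα.coeff_mul_prod_le ha ha0 hd hj) 2
  have hBR2 : ∀ R, 0 < R → B ^ 2 * a 0 ^ 2 * R ^ k ≤
      (∑ j ∈ Finset.range (d + 1), a j ^ 2 * R ^ j)
        * ∏ i ∈ Finset.range k, rootSeq α hd i ^ 2 := by
    intro R hR
    rw [Finset.prod_pow]
    exact hBR R hR
  have key : ∀ m δ, 0 ≤ δ → δ ≤ 1 → (δ ^ 2 < 1 → B ^ 2 ≤ valU m (δ ^ 2)) →
      ENNReal.ofReal c * (1 / (calU m (δ ^ 2)) ^ (1 / 2 : ℝ)) ^ n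
        ≤ ENNReal.ofReal Z / ENNReal.ofReal (∏ i ∈ Finset.range k, rootSeq α hd i) ^ n := by
    intro m δ h0 h1 h
    rcases h1.eq_or_lt with rfl | h1
    · rw [one_div_sqrt_calU_one]
      simp [hn.ne']
    · have h2 : δ ^ 2 < 1 := by nlinarith
      have hu := valU_pos (m := m) (sq_nonneg δ) h2
      rw [sqrt_calU_eq h0 h1]
      exact ofReal_mul_inv_pow_le hc hB (Real.sqrt_pos.2 hu) hZ hb hBn (Real.le_sqrt_of_sq_le (h h2))
  refine mul_max_pow_le (mul_sup_pow_le hn fun v hv => ?_) (mul_sup_pow_le hn fun v hv => ?_)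
  · obtain ⟨hv1, hv2⟩ := Finset.mem_filter.1 hv
    have hvd := le_of_mem_newtonVertices hv1
    have h0 := ratio_nonneg α k (v + 1)
    exact key _ _ h0 (ratio_le_one hd hα.1 hpos (by omega) (by omega)) fun h1 =>
      le_valU_of_roots_above (w := fun j => a j ^ 2) hβ2 hmono2 (pow_pos ha0 2) hw hBR2 hk hv2 hvd
        (sq_nonneg _) h1 fun h => by rw [rootSeq_pred_eq_ratio_mul_above hd hpos hk hkd h, mul_pow]
  · obtain ⟨hv1, hv2⟩ := Finset.mem_filter.1 hv
    have h0 := ratio_nonneg α v k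
    exact key _ _ h0 (ratio_le_one hd hα.1 hpos hv2.le (by omega)) fun h1 =>
      le_valU_of_roots_below (w := fun j => a j ^ 2) hβ2 hmono2 (pow_pos ha0 2) hw hBR2 hkd hv2
        (sq_nonneg _) h1 fun h => by rw [rootSeq_pred_eq_ratio_mul_below hd hpos hv2 hkd h, mul_pow]

/-- The gap constant `B` attached to the product `Z` of the moduli of `n * k` roots of `det P`. -/
lemma exists_gap_constant (hn : 0 < n) {D A Z b : ℝ} (hD : 0 ≤ D) (hA : 0 < A) (hZ : 0 < Z)
    (hb : 0 < b) : ∃ B : ℝ, 0 ≤ B ∧ B ^ n = D / A ^ n * b ^ n / Z := by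
  have h : 0 ≤ D / A ^ n * b ^ n / Z := by positivity
  exact ⟨_, Real.rpow_nonneg h _, Real.rpow_inv_natCast_pow h hn.ne'⟩

/-- The n-th root of the Jensen bound D r^{nk} ≤ M Z, with Z expressed through B. -/
lemma gap_constant_mul_pow_le (hn : 0 < n) {D A Z b B r M T : ℝ} (hA : 0 < A) (hZ : 0 < Z)
    (hb : 0 < b) (hB : 0 ≤ B) (hBn : B ^ n = D / A ^ n * b ^ n / Z) (hr : 0 < r)
    (hM : D * r ^ (n * k) ≤ M * Z) (hT : 0 ≤ T) (hMT : M ≤ T ^ n) :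
    B * A * r ^ k ≤ T * b := by
  refine (pow_le_pow_iff_left₀ (by positivity) (by positivity) hn.ne').1 ?_
  have h1 : D * r ^ (n * k) / Z ≤ T ^ n := ((div_le_iff₀ hZ).2 hM).trans hMT
  calc (B * A * r ^ k) ^ n = (D * r ^ (n * k) / Z) * b ^ n := by
        rw [mul_pow, mul_pow, hBn, ← pow_mul, mul_comm k n]
        field_simp
    _ ≤ T ^ n * b ^ n := by gcongr
    _ = (T * b) ^ n := (mul_pow _ _ _).symm

variable {ζ : Fin (n * P.natDegree) → OnePoint ℂ}

/-- An infinite eigenvalue among the first nk makes the right side ∞, since none of them is 0.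
Otherwise Z enters only through Jensen's bound. -/
lemma masterBound_of_finite (hP : (P.coeff 0).det ≠ 0) (hζ : IsEigenvalueList P ζ)
    (hpos : ∀ i, 0 < α i) (hd : 0 < P.natDegree) (hkd : k ≤ P.natDegree) {L : ℝ≥0∞}
    (h : ∀ Z : ℝ, 0 < Z → (∀ r : ℝ, 0 < r → ‖(P.coeff 0).det‖ * r ^ (n * k) ≤
        ((detPoly P).comp (Polynomial.C (r : ℂ) * Polynomial.X)).mahlerMeasure * Z) →
      ENNReal.ofReal (‖(P.coeff 0).det‖ / N (P.coeff 0) ^ n) * L ^ n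
        ≤ ENNReal.ofReal Z / ENNReal.ofReal (∏ i ∈ Finset.range k, rootSeq α hd i) ^ n) :
    MasterBound N P ζ α k L := by
  unfold MasterBound
  rw [prod_roots_eq hd hpos hkd]
  rcases prod_modulus_eq_top_or hP hζ (Nat.mul_le_mul_left n hkd) with htop | ⟨S, hS, hcard, hprod⟩
  · rw [htop, ENNReal.top_div_of_ne_top (ENNReal.pow_ne_top ENNReal.ofReal_ne_top)]
    exact le_top
  · rw [hprod]
    refine h _ ?_ fun r hr => ?_
    · by_contra hZ
      rw [ENNReal.ofReal_of_nonpos (not_lt.1 hZ)] at hprod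
      exact Finset.prod_ne_zero_iff.2 (fun i _ => eigenvalue_ne_zero hP hζ i) hprod
    · rw [← hcard, ← detPoly_coeff_zero]
      exact norm_coeff_zero_mul_pow_le hr hS

end Bounds

end TropicalBound

theorem corollary4p6 {n : ℕ} (N : Seminorm ℂ (Matrix (Fin n) (Fin n) ℂ))
    (hN : TropicalBound.IsNorm N)
    (P : Polynomial (Matrix (Fin n) (Fin n) ℂ)) (hP : (P.coeff 0).det ≠ 0)
    (a : ℕ → ℝ) (ha : ∀ j, a j = N (P.coeff j))
    (ζ : Fin (n * P.natDegree) → OnePoint ℂ) (hζ : TropicalBound.IsEigenvalueList P ζ)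
    (α : Fin P.natDegree → ℝ) (hα : TropicalBound.IsTropicalRoots a P.natDegree α)
    (k : ℕ) (hk : 1 ≤ k) (hkd : k ≤ P.natDegree) :
    -- the bound, and its improvement
    (TropicalBound.AssumptionOne N →
      TropicalBound.MasterBound N P ζ α k (TropicalBound.LOpt a α k)) ∧
    (TropicalBound.AssumptionTwo N →
      TropicalBound.MasterBound N P ζ α k (TropicalBound.LStarOpt a α k)) ∧
    TropicalBound.LOpt a α k ≤ TropicalBound.LStarOpt a α k ∧
    -- the constants are optimal among all admissible choices of the indices
    IsGreatest {L | ∃ kp, k < kp ∧ kp ≤ P.natDegree + 1 ∧ L = TropicalBound.LPlus α k kp}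
      (TropicalBound.LPlusOpt a α k) ∧
    IsGreatest {L | ∃ km, km < k ∧ L = TropicalBound.LMinus α k km}
      (TropicalBound.LMinusOpt a α k) ∧
    IsGreatest {L | ∃ kp, k < kp ∧ kp ≤ P.natDegree + 1 ∧ L = TropicalBound.LPlusStar α k kp}
      (TropicalBound.LPlusStarOpt a α k) ∧
    IsGreatest {L | ∃ km, km < k ∧ L = TropicalBound.LMinusStar α k km}
      (TropicalBound.LMinusStarOpt a α k) := by
  open TropicalBound in
  have hd : 0 < P.natDegree := hk.trans hkd
  -- For n = 0 the matrix ring is trivial, so P = 0 has degree 0.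
  have hn : 0 < n := by
    rcases Nat.eq_zero_or_pos n with rfl | hn
    · rw [Subsingleton.elim P 0, Polynomial.natDegree_zero] at hd
      exact absurd hd (lt_irrefl 0)
    · exact hn
  have hNpos : ∀ A, A ≠ 0 → 0 < N A := fun A hA =>
    (apply_nonneg N A).lt_of_ne fun h => hA (hN A h.symm)
  have hnonneg : ∀ j, 0 ≤ a j := fun j => by rw [ha]; exact apply_nonneg N _
  have hNe : 0 < N (P.coeff 0) := hNpos _ fun h => hP (by
    have : Nonempty (Fin n) := ⟨⟨0, hn⟩⟩
    rw [h, Matrix.det_zero])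
  have ha0 : 0 < a 0 := by rw [ha]; exact hNe
  have had : 0 < a P.natDegree := by
    rw [ha]
    refine hNpos _ fun h => ?_
    rw [Polynomial.coeff_natDegree, Polynomial.leadingCoeff_eq_zero] at h
    rw [h, Polynomial.natDegree_zero] at hd
    exact absurd hd (lt_irrefl 0)
  have hpos := hα.pos hnonneg ha0
  have hb := Finset.prod_pos (s := Finset.range k) fun i _ => rootSeq_pos hd hpos i
  refine ⟨fun hA => ?_, fun hA => ?_, LOpt_le_LStarOpt hd hα.1 hpos hkd,
    isGreatest_sup_vertices_above hα hd hpos had (F := fun m δ => 1 / calU m δ)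
      (fun _ => antitone_one_div_calU) (fun m => by simp [calU_one]) hk hkd,
    isGreatest_sup_vertices_below hα hd hpos had (F := fun m δ => 1 / calU m δ)
      (fun _ => antitone_one_div_calU) (fun m => by simp [calU_one]) hk hkd,
    isGreatest_sup_vertices_above hα hd hpos had
      (F := fun m δ => 1 / (calU m (δ ^ 2)) ^ (1 / 2 : ℝ))
      (fun δ _ => antitone_one_div_sqrt_calU δ) one_div_sqrt_calU_one hk hkd,
    isGreatest_sup_vertices_below hα hd hpos had
      (F := fun m δ => 1 / (calU m (δ ^ 2)) ^ (1 / 2 : ℝ))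
      (fun δ _ => antitone_one_div_sqrt_calU δ) one_div_sqrt_calU_one hk hkd⟩
  · refine masterBound_of_finite hP hζ hpos hd hkd fun Z hZ hM => ?_
    obtain ⟨B, hB, hBn⟩ := exists_gap_constant hn (norm_nonneg (P.coeff 0).det) hNe hZ hb
    refine mul_LOpt_pow_le hα hnonneg ha0 hd hk hkd hn (by positivity) hB hZ hBn fun R hR => ?_
    have h := mahlerMeasure_le_of_assumptionOne hn hA hP hNe hR
    simp only [← ha] at h
    rw [ha 0]
    exact gap_constant_mul_pow_le hn hNe hZ hb hB hBn hR (hM R hR)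
      (Finset.sum_nonneg fun j _ => mul_nonneg (hnonneg j) (pow_nonneg hR.le j)) h
  · refine masterBound_of_finite hP hζ hpos hd hkd fun Z hZ hM => ?_
    obtain ⟨B, hB, hBn⟩ := exists_gap_constant hn (norm_nonneg (P.coeff 0).det) hNe hZ hb
    refine mul_LStarOpt_pow_le hα hnonneg ha0 hd hk hkd hn (by positivity) hB hZ hBn fun R hR => ?_
    -- The radius r = √R turns r^{2j} into R^j.
    have hr := Real.sqrt_pos.2 hR
    have h := mahlerMeasure_sq_le_of_assumptionTwo hn hA hP hNe hr
    simp only [← ha, Real.sq_sqrt hR.le] at h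
    set T := ∑ j ∈ Finset.range (P.natDegree + 1), a j ^ 2 * R ^ j with hTdef
    have hT : 0 ≤ T := Finset.sum_nonneg fun j _ => by positivity
    have hMT : ((detPoly P).comp (Polynomial.C ((Real.sqrt R : ℝ) : ℂ)
        * Polynomial.X)).mahlerMeasure ≤ Real.sqrt T ^ n := by
      refine (pow_le_pow_iff_left₀ (Polynomial.mahlerMeasure_nonneg _) (by positivity)
        two_ne_zero).1 (h.trans (le_of_eq ?_))
      rw [← pow_mul, mul_comm n 2, pow_mul, Real.sq_sqrt hT]
    -- The n-th root is taken with √T in place of T; squaring then gives the estimate for B².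
    have h2 := gap_constant_mul_pow_le hn hNe hZ hb hB hBn hr (hM _ hr) (Real.sqrt_nonneg T) hMT
    have h3 := pow_le_pow_left₀ (by positivity) h2 2
    rw [mul_pow, mul_pow, mul_pow, Real.sq_sqrt hT, ← pow_mul, mul_comm k 2, pow_mul,
      Real.sq_sqrt hR.le, ← ha] at h3
    exact h3
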